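/- Let $d\ge 1$ and $2_\star<\alpha<2^\star$, where $2_\star=\frac 8d$, $2^\star=\infty$ if $d\le 4$ and $2^\star=\frac{8}{d-4}$ if $d\ge 5$. Put $\gamma_c=\frac d2-\frac4\alpha$ and $\alpha_c=\frac{d\alpha}{4}$. For complex-valued functions on $\mathbb R^d$ let $\|u\|_{\dot H^\gamma}=\||\nabla|^\gamma u\|_{L^2}$; elements of $\dot H^{\gamma_c}\cap\dot H^2$ are represented by functions whose Fourier transform (as a tempered distribution) is a function. Define $$E(u)=\tfrac12\|u\|_{\dot H^2}^2-\tfrac1{\alpha+2}\int_{\mathbb R^d}|u|^{\alpha+2}\,dx,\qquad H(f)=\frac{\|f\|_{L^{\alpha+2}}^{\alpha+2}}{\|f\|_{\dot H^{\gamma_c}}^{\alpha}\|f\|_{\dot H^2}^2},\qquad K(f)=\frac{\|f\|_{L^{\alpha+2}}^{\alpha+2}}{\|f\|_{L^{\alpha_c}}^{\alpha}\|f\|_{\dot H^2}^2}.$$ A Sobolev ground state is a maximizer $g$ of $H$ over $\dot H^{\gamma_c}\cap\dot H^2$ that solves $\Delta^2g+(-\Delta)^{\gamma_c}g-|g|^\alpha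 g=0$ in the sense of tempered distributions; $\mathcal G$ is the set of these. A Lebesgue ground state is a maximizer $h$ of $K$ over $L^{\alpha_c}\cap\dot H^2$ that solves $\Delta^2h+|h|^{\alpha_c-2}h-|h|^\alpha h=0$ in the sense of tempered distributions; $\mathcal H$ is the set of these. Let $S_{gs}=\inf_{g\in\mathcal G}\|g\|_{\dot H^{\gamma_c}}$ and $L_{gs}=\inf_{h\in\mathcal H}\|h\|_{L^{\alpha_c}}$, as elements of $[0,\infty]$. 1. All $g\in\mathcal G$ satisfy $\|g\|_{\dot H^{\gamma_c}}=S_{gs}$. If $u\in\dot H^{\gamma_c}\cap\dot H^2$ satisfies $\|u\|_{\dot H^{\gamma_c}}=S_{gs}$ and $E(u)=0$, then there are $g\in\mathcal G$, $\theta\in\mathbb R$, $\lambda>0$ and $x_0\in\mathbb R^d$ such that $$u(x)=e^{i\theta}\lambda^{4/\alpha}g(\lambda x+x_0).$$ 2. All $h\in\mathcal H$ satisfy $\|h\|_{L^{\alpha_c}}=L_{gs}$. If $u\in L^{\alpha_c}\cap\dot H^2$ satisfies $\|u\|_{L^{\alpha_c}}=L_{gs}$ and $E(u)=0$, then there are $h\in\mathcal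 H$, $\vartheta\in\mathbb R$, $\mu>0$ and $y_0\in\mathbb R^d$ such that $$u(x)=e^{i\vartheta}\mu^{4/\alpha}h(\mu x+y_0).$$ -/

import Mathlib

open MeasureTheory SchwartzMap FourierTransform Laplacian
open scoped ENNReal

noncomputable section

namespace FourthOrderNLS

/-- Euclidean space `ℝ^d`. -/
abbrev Space (d : ℕ) : Type := EuclideanSpace ℝ (Fin d)

/-- The critical Sobolev exponent `γ_c = d/2 - 4/α`. -/
def critSobolevExp (d : ℕ) (α : ℝ) : ℝ := (d : ℝ) / 2 - 4 / α

/-- The critical Lebesgue exponent `α_c = 2d/(d - 2γ_c) = dα/4`. -/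
def critLebesgueExp (d : ℕ) (α : ℝ) : ℝ := (d : ℝ) * α / 4

/-- The intercritical range `2_⋆ < α < 2^⋆`, where `2_⋆ = 8/d`, and `2^⋆ = ∞` for `d ≤ 4`,
`2^⋆ = 8/(d-4)` for `d ≥ 5`. -/
def Intercritical (d : ℕ) (α : ℝ) : Prop :=
  8 / (d : ℝ) < α ∧ (5 ≤ d → α < 8 / ((d : ℝ) - 4))

/-- All derivatives of `ψ` (including `ψ` itself) vanish at the origin. The Fourier transform is a
bijection between these functions and the space `𝓢₀`. -/
def FlatAtZero {d : ℕ} (ψ : 𝓢(Space d, ℂ)) : Prop :=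
  ∀ n : ℕ, iteratedFDeriv ℝ n (ψ : Space d → ℂ) 0 = 0

/-- The function `u`, seen as a tempered distribution, has the function `f` as its Fourier
transform (normalization `f ξ = ∫ exp (-2πi⟨x, ξ⟩) u x dx`). -/
def IsFourier {d : ℕ} (u f : Space d → ℂ) : Prop :=
  AEStronglyMeasurable u volume ∧ AEStronglyMeasurable f volume ∧
    ∀ ψ : 𝓢(Space d, ℂ),
      Integrable (fun x => u x * 𝓕 ψ x) ∧ Integrable (fun ξ => f ξ * ψ ξ) ∧
        ∫ x, u x * 𝓕 ψ x = ∫ ξ, f ξ * ψ ξ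

/-- The function `u`, seen as an element of `𝓢₀'` (that is, modulo polynomials), has the function
`f` as its Fourier transform: the identity is only tested against `ψ` flat at the origin. -/
def IsFourierModPoly {d : ℕ} (u f : Space d → ℂ) : Prop :=
  AEStronglyMeasurable u volume ∧ AEStronglyMeasurable f volume ∧
    ∀ ψ : 𝓢(Space d, ℂ), FlatAtZero ψ →
      Integrable (fun x => u x * 𝓕 ψ x) ∧ Integrable (fun ξ => f ξ * ψ ξ) ∧
        ∫ x, u x * 𝓕 ψ x = ∫ ξ, f ξ * ψ ξ

/-- The norm `‖u‖_{Ḣ^γ} = ‖|∇|^γ u‖_{L²} = ‖(2π|ξ|)^γ û‖_{L²}`, with value `∞` when `u` is not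
in `Ḣ^γ`. The function `f` below is unique up to null sets, so the infimum is over at most one
value. -/
def hdotNorm {d : ℕ} (γ : ℝ) (u : Space d → ℂ) : ℝ≥0∞ :=
  ⨅ (f : Space d → ℂ) (_ : IsFourierModPoly u f),
    eLpNorm (fun ξ => (((2 * Real.pi * ‖ξ‖) ^ γ : ℝ) : ℂ) * f ξ) 2 volume

/-- The norm `‖u‖_{L^p}`, with value `∞` when `u` is not in `L^p`. -/
def lebNorm {d : ℕ} (p : ℝ) (u : Space d → ℂ) : ℝ≥0∞ :=
  eLpNorm u (ENNReal.ofReal p) volume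

/-- The space `Ḣ^{γ_c} ∩ Ḣ²`. Since `γ_c < d/2`, every class modulo polynomials in this space
contains exactly one element whose Fourier transform is a function near the origin as well; this
is the function by which the class is represented. -/
def sobolevSpace (d : ℕ) (α : ℝ) : Set (Space d → ℂ) :=
  {u | (∃ f, IsFourier u f) ∧ hdotNorm (critSobolevExp d α) u < ∞ ∧ hdotNorm 2 u < ∞}

/-- The space `L^{α_c} ∩ Ḣ²`. -/
def lebesgueSpace (d : ℕ) (α : ℝ) : Set (Space d → ℂ) :=
  {u | MemLp u (ENNReal.ofReal (critLebesgueExp d α)) volume ∧ hdotNorm 2 u < ∞}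

/-- The energy `E(u) = ½ ∫ |Δu|² - 1/(α+2) ∫ |u|^{α+2}`. -/
def energy {d : ℕ} (α : ℝ) (u : Space d → ℂ) : ℝ :=
  1 / 2 * (hdotNorm 2 u).toReal ^ 2 - 1 / (α + 2) * ∫ x, ‖u x‖ ^ (α + 2)

/-- `H(f) = ‖f‖_{L^{α+2}}^{α+2} / (‖f‖_{Ḣ^{γ_c}}^α ‖f‖_{Ḣ²}²)`; the value at `f = 0` is `0`. -/
def functionalH {d : ℕ} (α : ℝ) (f : Space d → ℂ) : ℝ :=
  (lebNorm (α + 2) f).toReal ^ (α + 2) /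
    ((hdotNorm (critSobolevExp d α) f).toReal ^ α * (hdotNorm 2 f).toReal ^ 2)

/-- `K(f) = ‖f‖_{L^{α+2}}^{α+2} / (‖f‖_{L^{α_c}}^α ‖f‖_{Ḣ²}²)`; the value at `f = 0` is `0`. -/
def functionalK {d : ℕ} (α : ℝ) (f : Space d → ℂ) : ℝ :=
  (lebNorm (α + 2) f).toReal ^ (α + 2) /
    ((lebNorm (critLebesgueExp d α) f).toReal ^ α * (hdotNorm 2 f).toReal ^ 2)

/-- `Δ²Q + (-Δ)^{γ_c} Q - |Q|^α Q = 0` in the sense of tempered distributions, where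
`(-Δ)^{γ_c}` is the Fourier multiplier with symbol `(2π|ξ|)^{2γ_c}`. -/
def SolvesSobolevEq {d : ℕ} (α : ℝ) (Q : Space d → ℂ) : Prop :=
  ∃ f : Space d → ℂ, IsFourier Q f ∧ ∀ φ : 𝓢(Space d, ℂ),
    (∫ x, Q x * (Δ (Δ φ)) x)
      + (∫ ξ, (((2 * Real.pi * ‖ξ‖) ^ (2 * critSobolevExp d α) : ℝ) : ℂ) * f ξ * 𝓕⁻ φ ξ)
      - (∫ x, ((‖Q x‖ ^ α : ℝ) : ℂ) * Q x * φ x) = 0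

/-- `Δ²R + |R|^{α_c - 2} R - |R|^α R = 0` in the sense of tempered distributions. -/
def SolvesLebesgueEq {d : ℕ} (α : ℝ) (R : Space d → ℂ) : Prop :=
  ∀ φ : 𝓢(Space d, ℂ),
    (∫ x, R x * (Δ (Δ φ)) x)
      + (∫ x, ((‖R x‖ ^ (critLebesgueExp d α - 2) : ℝ) : ℂ) * R x * φ x)
      - (∫ x, ((‖R x‖ ^ α : ℝ) : ℂ) * R x * φ x) = 0

/-- The set `𝒢` of Sobolev ground states. -/
def sobolevGroundStates (d : ℕ) (α : ℝ) : Set (Space d → ℂ) :=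
  {g | g ∈ sobolevSpace d α ∧ IsMaxOn (functionalH α) (sobolevSpace d α) g ∧ SolvesSobolevEq α g}

/-- The set `ℋ` of Lebesgue ground states. -/
def lebesgueGroundStates (d : ℕ) (α : ℝ) : Set (Space d → ℂ) :=
  {h | h ∈ lebesgueSpace d α ∧ IsMaxOn (functionalK α) (lebesgueSpace d α) h ∧
    SolvesLebesgueEq α h}

/-- `S_gs`, the common value of `‖g‖_{Ḣ^{γ_c}}` over all Sobolev ground states `g`. -/
def sobolevCritNorm (d : ℕ) (α : ℝ) : ℝ≥0∞ :=
  ⨅ g ∈ sobolevGroundStates d α, hdotNorm (critSobolevExp d α) g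

/-- `L_gs`, the common value of `‖h‖_{L^{α_c}}` over all Lebesgue ground states `h`. -/
def lebesgueCritNorm (d : ℕ) (α : ℝ) : ℝ≥0∞ :=
  ⨅ h ∈ lebesgueGroundStates d α, lebNorm (critLebesgueExp d α) h

end FourthOrderNLS

end

open MeasureTheory SchwartzMap FourierTransform Laplacian
open scoped ENNReal
noncomputable section
namespace FourthOrderNLS

open Filter Topology ComplexConjugate

variable {d : ℕ}

/-! Write a maximizer's quotient as `A / (B * C)`, where `A = ‖·‖_{α+2}^{α+2}`, `C = ‖·‖²_{Ḣ²}` and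
`B` is the `α`-th power of the critical norm. The first variation of its logarithm is an
Euler–Lagrange equation with three explicit positive coefficients, that of `|u|^α u` being `(α+2)/A`
and that of `Δ²u` being `2/C` (`eulerLagrange_functionalH`, `eulerLagrange_functionalK`). Zero
energy says precisely that these two coefficients agree, and then the quotient equals `(α+2)/2 / B`.

A ground state satisfies its Euler–Lagrange equation and its normalized equation at once. If the
coefficients differed, a linear combination of the two would confine its Fourier transform to a
sphere, a null set. Hence ground states have zero energy (`coeff_eq_of_sobolevGroundState`,
`coeff_eq_of_lebesgueGroundState`); this takes the place of Pohozaev identities. The maximal value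
of the quotient then determines the critical norm, which is therefore common to all ground states.

Conversely, a zero-energy `u` with this critical norm has the maximal quotient, so it satisfies the
Euler–Lagrange equation. The dilation `l^{4/α} u(l x)` fixes the critical norm and multiplies `A`
and `C` by the same factor, so a suitable `l` makes all three coefficients equal, and dividing by
them yields the normalized equation (`exists_sobolevGroundState`, `exists_lebesgueGroundState`).
Thus `u` is a dilate of a ground state, with trivial phase and translation. Neither existence of
maximizers nor a Gagliardo–Nirenberg inequality is needed. -/

/-! ### Schwartz functions -/

/-- The complex conjugate of a Schwartz function. -/
def conjSchwartz (φ : 𝓢(Space d, ℂ)) : 𝓢(Space d, ℂ) :=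
  φ.postcompCLM (𝕜 := ℝ) (Complex.conjCLE : ℂ →L[ℝ] ℂ)

@[simp]
theorem conjSchwartz_apply (φ : 𝓢(Space d, ℂ)) (x : Space d) :
    conjSchwartz φ x = conj (φ x) := by
  simp [conjSchwartz]

theorem conj_fourier_conjSchwartz (φ : 𝓢(Space d, ℂ)) (ξ : Space d) :
    conj (𝓕 (conjSchwartz φ) ξ) = 𝓕⁻ φ ξ := by
  rw [fourier_coe, fourierInv_coe, Real.fourier_eq', Real.fourierInv_eq', ← integral_conj]
  congr 1 with x
  simp only [conjSchwartz_apply, smul_eq_mul, map_mul, Complex.conj_conj, ← Complex.exp_conj]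
  congr 2
  simp [Complex.conj_ofNat]

/-- The dilation `x ↦ φ (c • x)` of a Schwartz function. -/
def dilateSchwartz (c : ℝ) (hc : c ≠ 0) (φ : 𝓢(Space d, ℂ)) : 𝓢(Space d, ℂ) :=
  compCLMOfContinuousLinearEquiv ℂ
    (ContinuousLinearEquiv.smulLeft (Units.mk0 c hc) : Space d ≃L[ℝ] Space d) φ

@[simp]
theorem dilateSchwartz_apply (c : ℝ) (hc : c ≠ 0) (φ : 𝓢(Space d, ℂ)) (x : Space d) :
    dilateSchwartz c hc φ x = φ (c • x) := by
  simp [dilateSchwartz, Units.smul_def]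

theorem fourier_dilateSchwartz (c : ℝ) (hc : 0 < c) (φ : 𝓢(Space d, ℂ)) (ξ : Space d) :
    𝓕 (dilateSchwartz c hc.ne' φ) ξ = ((c ^ d)⁻¹ : ℝ) * 𝓕 φ (c⁻¹ • ξ) := by
  rw [fourier_coe, fourier_coe, Real.fourier_eq', Real.fourier_eq']
  have h := Measure.integral_comp_smul_of_nonneg (volume : Measure (Space d))
    (fun v => Complex.exp (↑(-2 * Real.pi * inner ℝ v (c⁻¹ • ξ)) * Complex.I) • φ v) c (hR := hc.le)
  simp only [finrank_euclideanSpace, Fintype.card_fin] at h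
  rw [← Complex.real_smul, ← h]
  congr 1 with x
  rw [dilateSchwartz_apply, inner_smul_left, inner_smul_right]
  congr 4
  simp
  field_simp

/-- The Fourier symbol `(2π|ξ|)^γ` of `|∇|^γ`. -/
def wt (γ : ℝ) (ξ : Space d) : ℝ := (2 * Real.pi * ‖ξ‖) ^ γ

theorem wt_nonneg (γ : ℝ) (ξ : Space d) : 0 ≤ wt γ ξ := by
  unfold wt; positivity

theorem wt_pos (γ : ℝ) {ξ : Space d} (hξ : ξ ≠ 0) : 0 < wt γ ξ := by
  unfold wt; have := norm_pos_iff.2 hξ; positivity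

theorem measurable_wt (γ : ℝ) : Measurable (wt γ : Space d → ℝ) := by
  unfold wt; fun_prop

theorem wt_two_mul (γ : ℝ) (ξ : Space d) : wt (2 * γ) ξ = wt γ ξ ^ 2 := by
  unfold wt
  rw [mul_comm 2 γ, Real.rpow_mul (by positivity)]
  exact_mod_cast Real.rpow_natCast _ 2

theorem fourierInv_apply_eq_fourier_neg (φ : 𝓢(Space d, ℂ)) (ξ : Space d) :
    𝓕⁻ φ ξ = 𝓕 φ (-ξ) := by
  rw [fourierInv_apply_eq]; rfl

theorem fourierInv_laplacian_laplacian (φ : 𝓢(Space d, ℂ)) (ξ : Space d) :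
    𝓕⁻ (Δ (Δ φ)) ξ = (wt (2 * 2) ξ : ℂ) * 𝓕⁻ φ ξ := by
  have key : ∀ (φ : 𝓢(Space d, ℂ)) (ξ : Space d),
      𝓕 (Δ φ) ξ = -(((2 * Real.pi * ‖ξ‖) ^ 2 : ℝ) : ℂ) * 𝓕 φ ξ := by
    intro φ ξ
    rw [laplacian_eq_fourierMultiplierCLM, fourierMultiplierCLM_apply]
    rw [FourierTransform.fourier_smul, FourierTransform.fourier_fourierInv_eq, smul_apply,
      smulLeftCLM_apply_apply (by fun_prop)]
    simp
    ring
  rw [fourierInv_apply_eq_fourier_neg, key, key, fourierInv_apply_eq_fourier_neg, norm_neg,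
    wt_two_mul]
  rw [wt, Real.rpow_two]
  push_cast
  ring

/-- The symbol need not be smooth at the origin, so multiplying by it can leave the Schwartz class;
a smooth majorant of temperate growth still gives the `L^p` bounds. -/
theorem wt_le (γ : ℝ) (hγ : 0 ≤ γ) (ξ : Space d) :
    wt γ ξ ≤ (1 + (2 * Real.pi) ^ 2 * ‖ξ‖ ^ 2) ^ ⌈γ⌉₊ := by
  unfold wt
  set r := 2 * Real.pi * ‖ξ‖ with hr
  have hr0 : 0 ≤ r := by positivity
  have h1 : (2 * Real.pi) ^ 2 * ‖ξ‖ ^ 2 = r ^ 2 := by rw [hr]; ring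
  rw [h1]
  calc r ^ γ ≤ (1 + r ^ 2) ^ γ := Real.rpow_le_rpow hr0 (by nlinarith) hγ
    _ ≤ (1 + r ^ 2) ^ (⌈γ⌉₊ : ℝ) :=
        Real.rpow_le_rpow_of_exponent_le (by nlinarith) (Nat.le_ceil γ)
    _ = _ := Real.rpow_natCast _ _

theorem memLp_wt_mul (γ : ℝ) (hγ : 0 ≤ γ) (p : ℝ≥0∞) (ψ : 𝓢(Space d, ℂ)) :
    MemLp (fun ξ => (wt γ ξ : ℂ) * ψ ξ) p volume := by
  let g : Space d → ℝ := fun ξ => (1 + (2 * Real.pi) ^ 2 * ‖ξ‖ ^ 2) ^ ⌈γ⌉₊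
  have hg : g.HasTemperateGrowth := by
    fun_prop
  refine (smulLeftCLM ℂ g ψ).memLp p |>.of_le
    (((Complex.measurable_ofReal.comp (measurable_wt γ)).aestronglyMeasurable).mul
      ψ.continuous.aestronglyMeasurable) (Eventually.of_forall fun ξ => ?_)
  rw [smulLeftCLM_apply_apply hg, norm_smul]
  change ‖(wt γ ξ : ℂ) * ψ ξ‖ ≤ _
  rw [norm_mul]
  refine mul_le_mul_of_nonneg_right ?_ (norm_nonneg _)
  rw [Complex.norm_real, Real.norm_of_nonneg (wt_nonneg _ _), Real.norm_of_nonneg (by positivity)]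
  exact wt_le γ hγ ξ

/-! ### Testing against Schwartz functions vanishing near the origin -/

/-- This is where `d ≥ 1` enters: in dimension zero the origin is the whole space. -/
theorem ae_ne_zero (hd : 1 ≤ d) : ∀ᵐ ξ : Space d, ξ ≠ 0 := by
  have : Nonempty (Fin d) := ⟨⟨0, hd⟩⟩
  simp [ae_iff]

theorem FlatAtZero.of_eventually_eq_zero {ψ : 𝓢(Space d, ℂ)} (h : ∀ᶠ ξ in 𝓝 0, ψ ξ = 0) :
    FlatAtZero ψ := by
  intro n
  have : (ψ : Space d → ℂ) =ᶠ[𝓝 0] fun _ => (0 : ℂ) := h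
  rw [(this.iteratedFDeriv ℝ n).eq_of_nhds]
  exact congrFun (iteratedFDeriv_fun_zero (𝕜 := ℝ) (E := Space d) (F := ℂ) (n := n)) 0

/-- A function annihilating the Schwartz functions that vanish near the origin is zero. -/
theorem ae_eq_zero_of_integral_schwartz_eq_zero (hd : 1 ≤ d) {F : Space d → ℂ}
    (h : ∀ ψ : 𝓢(Space d, ℂ), (∀ᶠ ξ in 𝓝 0, ψ ξ = 0) →
      Integrable (fun ξ => F ξ * ψ ξ) ∧ ∫ ξ, F ξ * ψ ξ = 0) :
    ∀ᵐ ξ, F ξ = 0 := by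
  have hU : IsOpen ({0}ᶜ : Set (Space d)) := isOpen_compl_singleton
  have mk : ∀ g : Space d → ℝ, ContDiff ℝ (⊤ : ℕ∞) g → HasCompactSupport g → tsupport g ⊆ {0}ᶜ →
      ∃ ψ : 𝓢(Space d, ℂ), (∀ ξ, ψ ξ = g ξ) ∧ ∀ᶠ ξ in 𝓝 0, ψ ξ = 0 := by
    intro g hg hgc hgU
    have hc : HasCompactSupport (fun ξ => (g ξ : ℂ)) :=
      hgc.comp_left (g := Complex.ofReal) Complex.ofReal_zero
    refine ⟨hc.toSchwartzMap (Complex.ofRealCLM.contDiff.comp hg), fun ξ => rfl, ?_⟩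
    have h0 : (0 : Space d) ∉ tsupport g := fun h0 => hgU h0 rfl
    filter_upwards [(isClosed_tsupport g).isOpen_compl.mem_nhds h0] with ξ hξ
    change ((g ξ : ℝ) : ℂ) = 0
    rw [image_eq_zero_of_notMem_tsupport hξ, Complex.ofReal_zero]
  -- Near `x ≠ 0`, `F` agrees with its product with a bump equal to `1` there, and that product is
  -- integrable by hypothesis.
  have hloc : LocallyIntegrableOn F ({0}ᶜ : Set (Space d)) volume := by
    intro x hx
    have hx' : 0 < ‖x‖ := norm_pos_iff.2 hx
    let b : ContDiffBump x := ⟨‖x‖ / 4, ‖x‖ / 2, by positivity, by linarith⟩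
    have hbU : tsupport b ⊆ ({0}ᶜ : Set (Space d)) := by
      rw [b.tsupport_eq]
      intro y hy hy0
      rw [Set.mem_singleton_iff.1 hy0, Metric.mem_closedBall, dist_zero_left] at hy
      change ‖x‖ ≤ ‖x‖ / 2 at hy
      linarith
    obtain ⟨ψ, hψ, hψ0⟩ := mk b b.contDiff b.hasCompactSupport hbU
    refine ⟨Metric.closedBall x (‖x‖ / 4),
      mem_nhdsWithin_of_mem_nhds (Metric.closedBall_mem_nhds x (by positivity)), ?_⟩
    refine (h ψ hψ0).1.integrableOn.congr_fun (fun y hy => ?_) measurableSet_closedBall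
    simp only [hψ]
    rw [b.one_of_mem_closedBall hy]
    simp
  have hae := hU.ae_eq_zero_of_integral_contDiff_smul_eq_zero hloc (by
    intro g hg hgc hgU
    obtain ⟨ψ, hψ, hψ0⟩ := mk g hg hgc hgU
    rw [← (h ψ hψ0).2]
    congr 1 with ξ
    rw [hψ, Complex.real_smul, mul_comm])
  filter_upwards [hae, ae_ne_zero hd] with ξ h1 h2 using h1 h2

/-! ### Fourier transforms of functions and homogeneous Sobolev norms -/

/-- The Parseval identity for the pair `u`, `f` tested against `ψ`. -/
def FourierTestedBy (u f : Space d → ℂ) (ψ : 𝓢(Space d, ℂ)) : Prop :=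
  Integrable (fun x => u x * 𝓕 ψ x) ∧ Integrable (fun ξ => f ξ * ψ ξ) ∧
    ∫ x, u x * 𝓕 ψ x = ∫ ξ, f ξ * ψ ξ

/-- Working with one test function at a time serves `IsFourier` and `IsFourierModPoly` alike. -/
theorem FourierTestedBy.add_mul {u v f g : Space d → ℂ} {ψ : 𝓢(Space d, ℂ)}
    (hu : FourierTestedBy u f ψ) (hv : FourierTestedBy v g ψ) (c : ℂ) :
    FourierTestedBy (fun x => u x + c * v x) (fun ξ => f ξ + c * g ξ) ψ := by
  have e1 : (fun x => (u x + c * v x) * 𝓕 ψ x) = fun x => u x * 𝓕 ψ x + c * (v x * 𝓕 ψ x) := by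
    ext x; ring
  have e2 : (fun x => (f x + c * g x) * ψ x) = fun x => f x * ψ x + c * (g x * ψ x) := by
    ext x; ring
  refine ⟨?_, ?_, ?_⟩
  · rw [e1]; exact hu.1.add (hv.1.const_mul c)
  · rw [e2]; exact hu.2.1.add (hv.2.1.const_mul c)
  · rw [e1, e2, integral_add hu.1 (hv.1.const_mul c), integral_add hu.2.1 (hv.2.1.const_mul c),
      integral_const_mul, integral_const_mul, hu.2.2, hv.2.2]

theorem FourierTestedBy.dilate {u f : Space d → ℂ} {ψ : 𝓢(Space d, ℂ)} {l : ℝ} (hl : 0 < l)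
    (hu : FourierTestedBy u f (dilateSchwartz l hl.ne' ψ)) (c : ℂ) :
    FourierTestedBy (fun x => c * u (l • x)) (fun ξ => c * ((l ^ d)⁻¹ : ℝ) * f (l⁻¹ • ξ)) ψ := by
  have hl' : 0 < l ^ d := by positivity
  obtain ⟨h1, h2, h3⟩ := hu
  have hlc : (l : ℂ) ≠ 0 := by exact_mod_cast hl.ne'
  have e1 : (fun x => c * u (l • x) * 𝓕 ψ x) = fun x => c * (l ^ d : ℝ) *
      (fun y => u y * 𝓕 (dilateSchwartz l hl.ne' ψ) y) (l • x) := by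
    ext x
    simp only [fourier_dilateSchwartz l hl, smul_smul, inv_mul_cancel₀ hl.ne', one_smul]
    push_cast
    field_simp
  have e2 : (fun ξ => c * ((l ^ d)⁻¹ : ℝ) * f (l⁻¹ • ξ) * ψ ξ) = fun ξ => c * ((l ^ d)⁻¹ : ℝ) *
      (fun η => f η * dilateSchwartz l hl.ne' ψ η) (l⁻¹ • ξ) := by
    ext x
    simp only [dilateSchwartz_apply, smul_smul, mul_inv_cancel₀ hl.ne', one_smul]
    ring
  refine ⟨?_, ?_, ?_⟩
  · rw [e1]; exact (h1.comp_smul hl.ne').const_mul _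
  · rw [e2]; exact (h2.comp_smul (inv_pos.2 hl).ne').const_mul _
  · rw [e1, e2, integral_const_mul, integral_const_mul,
      Measure.integral_comp_smul_of_nonneg volume
        (fun y => u y * 𝓕 (dilateSchwartz l hl.ne' ψ) y) l (hR := hl.le),
      Measure.integral_comp_smul_of_nonneg volume
        (fun η => f η * dilateSchwartz l hl.ne' ψ η) l⁻¹ (hR := (inv_pos.2 hl).le), h3]
    simp only [finrank_euclideanSpace, Fintype.card_fin, Complex.real_smul, inv_pow, inv_inv]
    push_cast
    field_simp

theorem FlatAtZero.dilate {ψ : 𝓢(Space d, ℂ)} (hψ : FlatAtZero ψ) {l : ℝ} (hl : l ≠ 0) :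
    FlatAtZero (dilateSchwartz l hl ψ) := by
  intro n
  have h := (ContinuousLinearEquiv.smulLeft (Units.mk0 l hl) :
    Space d ≃L[ℝ] Space d).toContinuousLinearMap.iteratedFDeriv_comp_right
      (f := (ψ : Space d → ℂ)) (ψ.smooth ⊤) 0 (i := n) (by exact_mod_cast le_top)
  have e : (dilateSchwartz l hl ψ : Space d → ℂ) = ψ ∘ (ContinuousLinearEquiv.smulLeft
      (Units.mk0 l hl) : Space d ≃L[ℝ] Space d).toContinuousLinearMap := rfl
  rw [e, h, map_zero, hψ n]
  ext; simp

theorem aestronglyMeasurable_comp_smul {f : Space d → ℂ} (hf : AEStronglyMeasurable f volume)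
    {l : ℝ} (hl : l ≠ 0) : AEStronglyMeasurable (fun x => f (l • x)) volume := by
  refine hf.comp_quasiMeasurePreserving ⟨by fun_prop, ?_⟩
  rw [Measure.map_addHaar_smul _ hl]
  exact Measure.smul_absolutelyContinuous

theorem IsFourier.modPoly {u f : Space d → ℂ} (h : IsFourier u f) : IsFourierModPoly u f :=
  ⟨h.1, h.2.1, fun ψ _ => h.2.2 ψ⟩

theorem isFourier_schwartz (φ : 𝓢(Space d, ℂ)) : IsFourier φ (𝓕 φ : 𝓢(Space d, ℂ)) := by
  refine ⟨φ.continuous.aestronglyMeasurable, (𝓕 φ).continuous.aestronglyMeasurable, fun ψ => ?_⟩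
  have aux : ∀ f g : 𝓢(Space d, ℂ), Integrable (fun x => f x * g x) := fun f g =>
    g.integrable.bdd_mul f.continuous.aestronglyMeasurable
      (c := SchwartzMap.seminorm ℝ 0 0 f) (Eventually.of_forall fun x => norm_le_seminorm ℝ f x)
  exact ⟨aux _ _, aux _ _, (integral_fourier_mul_eq φ ψ).symm⟩

theorem IsFourier.add_schwartz {u f : Space d → ℂ} (h : IsFourier u f) (c : ℂ)
    (φ : 𝓢(Space d, ℂ)) : IsFourier (fun x => u x + c * φ x) (fun ξ => f ξ + c * 𝓕 φ ξ) := by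
  have hφ := isFourier_schwartz φ
  exact ⟨h.1.add (hφ.1.const_mul c), h.2.1.add (hφ.2.1.const_mul c),
    fun ψ => FourierTestedBy.add_mul (h.2.2 ψ) (hφ.2.2 ψ) c⟩

theorem IsFourierModPoly.add_schwartz {u f : Space d → ℂ} (h : IsFourierModPoly u f) (c : ℂ)
    (φ : 𝓢(Space d, ℂ)) :
    IsFourierModPoly (fun x => u x + c * φ x) (fun ξ => f ξ + c * 𝓕 φ ξ) := by
  have hφ := isFourier_schwartz φ
  exact ⟨h.1.add (hφ.1.const_mul c), h.2.1.add (hφ.2.1.const_mul c),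
    fun ψ hψ => FourierTestedBy.add_mul (h.2.2 ψ hψ) (hφ.2.2 ψ) c⟩

theorem IsFourier.dilate {u f : Space d → ℂ} (h : IsFourier u f) {l : ℝ} (hl : 0 < l) (c : ℂ) :
    IsFourier (fun x => c * u (l • x)) (fun ξ => c * ((l ^ d)⁻¹ : ℝ) * f (l⁻¹ • ξ)) :=
  ⟨(aestronglyMeasurable_comp_smul h.1 hl.ne').const_mul _,
    (aestronglyMeasurable_comp_smul h.2.1 (inv_pos.2 hl).ne').const_mul _,
    fun ψ => FourierTestedBy.dilate hl (h.2.2 (dilateSchwartz l hl.ne' ψ)) c⟩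

theorem IsFourierModPoly.dilate {u f : Space d → ℂ} (h : IsFourierModPoly u f) {l : ℝ}
    (hl : 0 < l) (c : ℂ) :
    IsFourierModPoly (fun x => c * u (l • x)) (fun ξ => c * ((l ^ d)⁻¹ : ℝ) * f (l⁻¹ • ξ)) :=
  ⟨(aestronglyMeasurable_comp_smul h.1 hl.ne').const_mul _,
    (aestronglyMeasurable_comp_smul h.2.1 (inv_pos.2 hl).ne').const_mul _,
    fun ψ hψ => FourierTestedBy.dilate hl (h.2.2 (dilateSchwartz l hl.ne' ψ) (hψ.dilate hl.ne')) c⟩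

/-- Test functions vanishing near the origin are flat there, and they determine a function off a
null set. This makes the infimum in `hdotNorm` a single value. -/
theorem IsFourierModPoly.ae_eq (hd : 1 ≤ d) {u f g : Space d → ℂ} (hf : IsFourierModPoly u f)
    (hg : IsFourierModPoly u g) : f =ᵐ[volume] g := by
  have := ae_eq_zero_of_integral_schwartz_eq_zero hd (F := fun ξ => f ξ - g ξ) (by
    intro ψ hψ
    obtain ⟨-, a2, a3⟩ := hf.2.2 ψ (.of_eventually_eq_zero hψ)
    obtain ⟨-, b2, b3⟩ := hg.2.2 ψ (.of_eventually_eq_zero hψ)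
    have e : (fun ξ => (f ξ - g ξ) * ψ ξ) = fun ξ => f ξ * ψ ξ - g ξ * ψ ξ := by ext; ring
    rw [e]
    exact ⟨a2.sub b2, by rw [integral_sub a2 b2, ← a3, ← b3, sub_self]⟩)
  filter_upwards [this] with ξ hξ using sub_eq_zero.1 hξ

theorem hdotNorm_eq (hd : 1 ≤ d) {u f : Space d → ℂ} (hf : IsFourierModPoly u f) (γ : ℝ) :
    hdotNorm γ u = eLpNorm (fun ξ => (wt γ ξ : ℂ) * f ξ) 2 volume := by
  refine le_antisymm (iInf₂_le f hf) (le_iInf₂ fun g hg => le_of_eq ?_)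
  refine eLpNorm_congr_ae ?_
  filter_upwards [hf.ae_eq hd hg] with ξ hξ
  simp only [hξ, wt]

theorem exists_isFourierModPoly {γ : ℝ} {u : Space d → ℂ} (h : hdotNorm γ u < ∞) :
    ∃ f, IsFourierModPoly u f := by
  by_contra hn
  push Not at hn
  simp [hdotNorm, hn] at h

theorem memLp_of_hdotNorm_lt_top (hd : 1 ≤ d) {γ : ℝ} {u f : Space d → ℂ}
    (hf : IsFourierModPoly u f) (h : hdotNorm γ u < ∞) :
    MemLp (fun ξ => (wt γ ξ : ℂ) * f ξ) 2 volume :=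
  ⟨(Complex.measurable_ofReal.comp (measurable_wt γ)).aestronglyMeasurable.mul hf.2.1,
    hdotNorm_eq hd hf γ ▸ h⟩

/-! ### Norms as integrals, and their scaling -/

theorem sq_toReal_eLpNorm_two {F : Space d → ℂ} (hF : MemLp F 2 volume) :
    (eLpNorm F 2 volume).toReal ^ 2 = ∫ x, ‖F x‖ ^ 2 := by
  have h0 : 0 ≤ ∫ x, ‖F x‖ ^ 2 := integral_nonneg fun x => by positivity
  rw [hF.eLpNorm_eq_integral_rpow_norm two_ne_zero ENNReal.ofNat_ne_top]
  simp only [ENNReal.toReal_ofNat, Real.rpow_two]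
  rw [ENNReal.toReal_ofReal (by positivity), ← Real.rpow_natCast, ← Real.rpow_mul h0]
  norm_num

theorem toReal_lebNorm_rpow {p : ℝ} (hp : 0 < p) {u : Space d → ℂ}
    (hu : MemLp u (ENNReal.ofReal p) volume) :
    (lebNorm p u).toReal ^ p = ∫ x, ‖u x‖ ^ p := by
  have h0 : 0 ≤ ∫ x, ‖u x‖ ^ p := integral_nonneg fun x => by positivity
  rw [lebNorm, hu.eLpNorm_eq_integral_rpow_norm (by simpa using hp) ENNReal.ofReal_ne_top,
    ENNReal.toReal_ofReal hp.le, ENNReal.toReal_ofReal (by positivity), ← Real.rpow_mul h0,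
    inv_mul_cancel₀ hp.ne', Real.rpow_one]

theorem eLpNorm_comp_smul (f : Space d → ℂ) {p : ℝ} (hp : 0 < p) {l : ℝ}
    (hl : 0 < l) : eLpNorm (fun x => f (l • x)) (ENNReal.ofReal p) volume =
      ENNReal.ofReal (l ^ (-(d : ℝ) / p)) * eLpNorm f (ENNReal.ofReal p) volume := by
  have h1 : eLpNorm (fun x => f (l • x)) (ENNReal.ofReal p) volume =
      eLpNorm f (ENNReal.ofReal p) (Measure.map (l • ·) (volume : Measure (Space d))) :=
    ((Homeomorph.smulOfNeZero l hl.ne').measurableEmbedding.eLpNorm_map_measure).symm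
  rw [h1, Measure.map_addHaar_smul _ hl.ne', eLpNorm_smul_measure_of_ne_top ENNReal.ofReal_ne_top,
    smul_eq_mul]
  congr 1
  rw [one_div, ENNReal.toReal_inv, ENNReal.toReal_ofReal hp.le,
    ENNReal.ofReal_rpow_of_nonneg (abs_nonneg _) (by positivity),
    abs_of_pos (by positivity)]
  simp only [finrank_euclideanSpace, Fintype.card_fin]
  rw [← Real.rpow_natCast, ← Real.rpow_neg hl.le, ← Real.rpow_mul hl.le]
  congr 2

theorem lebNorm_dilate (u : Space d → ℂ) {p : ℝ} (hp : 0 < p) {l : ℝ} (hl : 0 < l) {c : ℝ}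
    (hc : 0 ≤ c) : lebNorm p (fun x => (c : ℂ) * u (l • x)) =
      ENNReal.ofReal (c * l ^ (-(d : ℝ) / p)) * lebNorm p u := by
  have : (fun x => (c : ℂ) * u (l • x)) = (c : ℂ) • fun x => u (l • x) := rfl
  rw [lebNorm, this, eLpNorm_const_smul, eLpNorm_comp_smul u hp hl, ← mul_assoc, lebNorm,
    ENNReal.ofReal_mul hc]
  congr 2
  rw [← ofReal_norm, Complex.norm_real, Real.norm_of_nonneg hc]

theorem hdotNorm_dilate (hd : 1 ≤ d) {u f : Space d → ℂ} (hf : IsFourierModPoly u f) (γ : ℝ)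
    {l : ℝ} (hl : 0 < l) {c : ℝ} (hc : 0 ≤ c) : hdotNorm γ (fun x => (c : ℂ) * u (l • x)) =
      ENNReal.ofReal (c * l ^ (γ - (d : ℝ) / 2)) * hdotNorm γ u := by
  rw [hdotNorm_eq hd (hf.dilate hl c), hdotNorm_eq hd hf]
  have e : (fun ξ => (wt γ ξ : ℂ) * (c * ((l ^ d)⁻¹ : ℝ) * f (l⁻¹ • ξ))) = fun ξ =>
      ((c * (l ^ d)⁻¹ * l ^ γ : ℝ) : ℂ) * (fun η => (wt γ η : ℂ) * f η) (l⁻¹ • ξ) := by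
    ext ξ
    have : wt γ ξ = l ^ γ * wt γ (l⁻¹ • ξ) := by
      unfold wt
      rw [norm_smul, Real.norm_of_nonneg (inv_pos.2 hl).le, ← Real.mul_rpow hl.le (by positivity)]
      congr 1
      field_simp
    rw [this]
    push_cast
    ring
  have h2 := lebNorm_dilate (fun η => (wt γ η : ℂ) * f η) two_pos (inv_pos.2 hl)
    (c := c * (l ^ d)⁻¹ * l ^ γ) (by positivity)
  simp only [lebNorm, ENNReal.ofReal_ofNat] at h2
  rw [e, h2]
  congr 2
  rw [← Real.rpow_natCast, ← Real.rpow_neg hl.le, mul_assoc, mul_assoc,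
    Real.inv_rpow hl.le, ← Real.rpow_neg hl.le, ← Real.rpow_add hl, ← Real.rpow_add hl]
  congr 2
  ring

/-! ### Removing low frequencies from a test function -/

theorem integral_norm_fourierInv (φ : 𝓢(Space d, ℂ)) : ∫ x, ‖𝓕⁻ φ x‖ = ∫ x, ‖𝓕 φ x‖ := by
  simp only [fourierInv_apply_eq_fourier_neg]
  exact integral_neg_eq_self (fun x => ‖𝓕 φ x‖) volume

/-- The `L¹` norm of the transform is dilation invariant, so shrinking cutoffs obey a uniform bound.
-/
theorem integral_norm_fourier_dilateSchwartz {l : ℝ} (hl : 0 < l) (φ : 𝓢(Space d, ℂ)) :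
    ∫ x, ‖𝓕 (dilateSchwartz l hl.ne' φ) x‖ = ∫ x, ‖𝓕 φ x‖ := by
  simp only [fourier_dilateSchwartz l hl, norm_mul]
  rw [integral_const_mul, Measure.integral_comp_smul_of_nonneg volume
        (fun y => ‖𝓕 φ y‖) l⁻¹ (hR := (inv_pos.2 hl).le)]
  simp only [finrank_euclideanSpace, Fintype.card_fin, inv_pow, inv_inv, smul_eq_mul,
    Complex.norm_real]
  rw [Real.norm_of_nonneg (by positivity), inv_mul_cancel_left₀ (by positivity)]

/-- The pointwise product of two Schwartz functions. -/
def mulSchwartz (χ ψ : 𝓢(Space d, ℂ)) : 𝓢(Space d, ℂ) :=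
  pairing (ContinuousLinearMap.mul ℂ ℂ) χ ψ

@[simp]
theorem mulSchwartz_apply (χ ψ : 𝓢(Space d, ℂ)) (x : Space d) :
    mulSchwartz χ ψ x = χ x * ψ x := by
  simp [mulSchwartz, pairing_apply_apply]

/-- The transform of a product is a convolution, and convolution is bounded on `L¹`. The inverse
transform has the same `L¹` norms and fits the way `SchwartzMap.convolution` unfolds. -/
theorem integral_norm_fourier_mulSchwartz_le (χ ψ : 𝓢(Space d, ℂ)) :
    ∫ x, ‖𝓕 (mulSchwartz χ ψ) x‖ ≤ (∫ x, ‖𝓕 χ x‖) * ∫ x, ‖𝓕 ψ x‖ := by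
  have hconv : 𝓕⁻ (mulSchwartz χ ψ) =
      SchwartzMap.convolution (ContinuousLinearMap.mul ℂ ℂ) (𝓕⁻ χ) (𝓕⁻ ψ) := by
    simp [SchwartzMap.convolution, mulSchwartz]
  rw [← integral_norm_fourierInv, ← integral_norm_fourierInv χ, ← integral_norm_fourierInv ψ, hconv]
  have ha := (𝓕⁻ χ).integrable (μ := volume) |>.norm
  have hb := (𝓕⁻ ψ).integrable (μ := volume) |>.norm
  rw [← smul_eq_mul, ← ContinuousLinearMap.lsmul_apply (𝕜 := ℝ) (R := ℝ),
    ← integral_convolution (ContinuousLinearMap.lsmul ℝ ℝ) ha hb]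
  refine integral_mono (SchwartzMap.integrable _).norm
    (ha.integrable_convolution (ContinuousLinearMap.lsmul ℝ ℝ) hb) fun x => ?_
  rw [convolution_apply]
  refine (norm_integral_le_integral_norm _).trans (le_of_eq ?_)
  simp [MeasureTheory.convolution]

theorem integrable_mul_schwartz {u : Space d → ℂ} {p : ℝ} (hp : 1 < p)
    (hu : MemLp u (ENNReal.ofReal p) volume) (φ : 𝓢(Space d, ℂ)) :
    Integrable (fun x => u x * φ x) := by
  have := (Real.HolderConjugate.conjExponent hp).ennrealOfReal
  exact hu.integrable_mul (φ.memLp (ENNReal.ofReal p.conjExponent))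

/-- The Fourier transforms of the low-frequency parts of a Schwartz function tend weakly to zero
in `L^p`, so that test functions may be replaced by test functions vanishing near the origin. -/
theorem exists_approx_vanishing_near_zero {u : Space d → ℂ} {p : ℝ} (hp : 1 < p)
    (hu : MemLp u (ENNReal.ofReal p) volume) (hd : 1 ≤ d) (ψ : 𝓢(Space d, ℂ)) :
    ∃ ψn : ℕ → 𝓢(Space d, ℂ), (∀ n, ∀ᶠ ξ in 𝓝 0, ψn n ξ = 0) ∧
      (∀ n ξ, ‖ψn n ξ‖ ≤ ‖ψ ξ‖) ∧ (∀ ξ ≠ 0, Tendsto (fun n => ψn n ξ) atTop (𝓝 (ψ ξ))) ∧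
      Tendsto (fun n => ∫ x, u x * 𝓕 (ψn n) x) atTop (𝓝 (∫ x, u x * 𝓕 ψ x)) := by
  let b : ContDiffBump (0 : Space d) := ⟨1, 2, one_pos, one_lt_two⟩
  have hbc : HasCompactSupport (fun ξ => (b ξ : ℂ)) :=
    b.hasCompactSupport.comp_left (g := Complex.ofReal) Complex.ofReal_zero
  let χ : 𝓢(Space d, ℂ) := hbc.toSchwartzMap (Complex.ofRealCLM.contDiff.comp b.contDiff)
  have hχ : ∀ ξ, χ ξ = b ξ := fun ξ => rfl
  have hn : ∀ n : ℕ, (0 : ℝ) < n + 1 := fun n => by positivity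
  let low : ℕ → 𝓢(Space d, ℂ) := fun n => mulSchwartz (dilateSchwartz (n + 1) (hn n).ne' χ) ψ
  have hlow : ∀ n ξ, low n ξ = b (((n : ℝ) + 1) • ξ) * ψ ξ := fun n ξ => by
    simp [low, hχ]
  have hlowle : ∀ n ξ, ‖low n ξ‖ ≤ ‖ψ ξ‖ := fun n ξ => by
    rw [hlow, norm_mul, Complex.norm_real, Real.norm_of_nonneg b.nonneg]
    exact mul_le_of_le_one_left (norm_nonneg _) b.le_one
  have hlowz : ∀ ξ ≠ 0, ∀ᶠ n in atTop, low n ξ = 0 := by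
    intro ξ hξ
    have hξ' := norm_pos_iff.2 hξ
    filter_upwards [eventually_ge_atTop ⌈2 / ‖ξ‖⌉₊] with n hn'
    rw [hlow, b.zero_of_le_dist, Complex.ofReal_zero, zero_mul]
    have h2 := Nat.ceil_le.1 hn'
    rw [div_le_iff₀ hξ'] at h2
    rw [dist_zero_right, norm_smul, Real.norm_of_nonneg (hn n).le]
    change (2 : ℝ) ≤ _
    nlinarith
  have hM : Tendsto (fun n => ∫ ξ, ‖low n ξ‖) atTop (𝓝 0) := by
    have := tendsto_integral_of_dominated_convergence (μ := volume) (F := fun n ξ => ‖low n ξ‖)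
      (f := fun _ => (0 : ℝ)) (fun ξ => ‖ψ ξ‖)
      (fun n => (low n).continuous.norm.aestronglyMeasurable) ψ.integrable.norm
      (fun n => Eventually.of_forall fun ξ => by simpa using hlowle n ξ)
      (by
        filter_upwards [ae_ne_zero hd] with ξ hξ
        refine tendsto_const_nhds.congr' ?_
        filter_upwards [hlowz ξ hξ] with n hn'
        simp [hn'])
    simpa using this
  have hint : ∀ φ : 𝓢(Space d, ℂ), Integrable (fun x => u x * φ x) :=
    fun φ => integrable_mul_schwartz hp hu φ
  -- By Hölder it suffices that `𝓕 (low n)` tends to `0` in `L^q`, with `q` conjugate to `p`. Its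
  -- sup norm is at most `∫ ‖low n‖ → 0` and its `L¹` norm is at most `L`; interpolation gives the
  -- limit because `q > 1`.
  have hlow0 : Tendsto (fun n => ∫ x, u x * 𝓕 (low n) x) atTop (𝓝 0) := by
    set q := p.conjExponent with hq
    have hpq : p.HolderConjugate q := .conjExponent hp
    set L := (∫ x, ‖𝓕 χ x‖) * ∫ x, ‖𝓕 ψ x‖ with hL
    have hL0 : 0 ≤ L := mul_nonneg (integral_nonneg fun _ => norm_nonneg _)
      (integral_nonneg fun _ => norm_nonneg _)
    have hbound : ∀ n, ‖∫ x, u x * 𝓕 (low n) x‖ ≤ (∫ x, ‖u x‖ ^ p) ^ (1 / p) *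
        ((∫ ξ, ‖low n ξ‖) ^ (q - 1) * L) ^ (1 / q) := by
      intro n
      have hsup : ∀ x, ‖𝓕 (low n) x‖ ≤ ∫ ξ, ‖low n ξ‖ := fun x => by
        rw [fourier_coe]
        exact VectorFourier.norm_fourierIntegral_le_integral_norm _ _ _ _ _
      have hm0 : 0 ≤ ∫ ξ, ‖low n ξ‖ := integral_nonneg fun _ => norm_nonneg _
      calc ‖∫ x, u x * 𝓕 (low n) x‖ ≤ ∫ x, ‖u x‖ * ‖𝓕 (low n) x‖ := by
            simpa only [norm_mul] using norm_integral_le_integral_norm (fun x => u x * 𝓕 (low n) x)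
        _ ≤ (∫ x, ‖u x‖ ^ p) ^ (1 / p) * (∫ x, ‖𝓕 (low n) x‖ ^ q) ^ (1 / q) :=
            integral_mul_norm_le_Lp_mul_Lq hpq hu ((𝓕 (low n)).memLp _)
        _ ≤ _ := by
            refine mul_le_mul_of_nonneg_left (Real.rpow_le_rpow
              (integral_nonneg fun x => by positivity) ?_ (by simpa using hpq.symm.nonneg))
              (Real.rpow_nonneg (integral_nonneg fun x => by positivity) _)
            calc ∫ x, ‖𝓕 (low n) x‖ ^ q
                ≤ ∫ x, (∫ ξ, ‖low n ξ‖) ^ (q - 1) * ‖𝓕 (low n) x‖ := by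
                  refine integral_mono_of_nonneg (Eventually.of_forall fun x => by positivity)
                    ((𝓕 (low n)).integrable.norm.const_mul _) (Eventually.of_forall fun x => ?_)
                  change ‖𝓕 (low n) x‖ ^ q ≤ _ * _
                  have : ‖𝓕 (low n) x‖ ^ q = ‖𝓕 (low n) x‖ ^ (q - 1) * ‖𝓕 (low n) x‖ := by
                    rw [← Real.rpow_add_one' (norm_nonneg _) (by linarith [hpq.symm.lt])]
                    ring_nf
                  rw [this]
                  exact mul_le_mul_of_nonneg_right (Real.rpow_le_rpow (norm_nonneg _) (hsup x)
                    (by linarith [hpq.symm.lt])) (norm_nonneg _)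
              _ = (∫ ξ, ‖low n ξ‖) ^ (q - 1) * ∫ x, ‖𝓕 (low n) x‖ := integral_const_mul _ _
              _ ≤ _ := by
                  gcongr
                  rw [hL, ← integral_norm_fourier_dilateSchwartz (hn n) χ]
                  exact integral_norm_fourier_mulSchwartz_le _ _
    have hq1 : 0 < q - 1 := by linarith [hpq.symm.lt]
    refine squeeze_zero_norm hbound ?_
    have h1 : Tendsto (fun n => (∫ ξ, ‖low n ξ‖) ^ (q - 1)) atTop (𝓝 0) := by
      simpa [Real.zero_rpow hq1.ne'] using hM.rpow_const (Or.inr hq1.le)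
    have h2 := ((h1.mul_const L).rpow_const (p := 1 / q)
      (Or.inr (by have := hpq.symm.pos; positivity))).const_mul ((∫ x, ‖u x‖ ^ p) ^ (1 / p))
    have hq' : 1 / q ≠ 0 := by have := hpq.symm.pos; positivity
    rwa [zero_mul, Real.zero_rpow hq', mul_zero] at h2
  refine ⟨fun n => ψ - low n, fun n => ?_, fun n ξ => ?_, fun ξ hξ => ?_, ?_⟩
  · filter_upwards [Metric.closedBall_mem_nhds (0 : Space d) (inv_pos.2 (hn n))] with ξ hξ
    rw [sub_apply, hlow, b.one_of_mem_closedBall, Complex.ofReal_one, one_mul, sub_self]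
    rw [mem_closedBall_zero_iff] at hξ ⊢
    rw [norm_smul, Real.norm_of_nonneg (hn n).le]
    change _ ≤ (1 : ℝ)
    rwa [← le_inv_mul_iff₀ (hn n), mul_one]
  · have : (ψ - low n) ξ = ((1 - b (((n : ℝ) + 1) • ξ) : ℝ) : ℂ) * ψ ξ := by
      rw [sub_apply, hlow]; push_cast; ring
    rw [this, norm_mul, Complex.norm_real, Real.norm_of_nonneg (sub_nonneg.2 b.le_one)]
    exact mul_le_of_le_one_left (norm_nonneg _) (by linarith [b.nonneg (x := ((n : ℝ) + 1) • ξ)])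
  · refine tendsto_const_nhds.congr' ?_
    filter_upwards [hlowz ξ hξ] with n hn'
    simp [hn']
  · have e : ∀ n, ∫ x, u x * 𝓕 (ψ - low n) x = (∫ x, u x * 𝓕 ψ x) - ∫ x, u x * 𝓕 (low n) x := by
      intro n
      rw [← integral_sub (hint _) (hint _)]
      congr 1 with x
      have : 𝓕 (ψ - low n) = 𝓕 ψ - 𝓕 (low n) := map_sub (fourierTransformCLM ℂ) ψ (low n)
      rw [this, sub_apply]
      ring
    simp only [e]
    simpa using (tendsto_const_nhds (x := ∫ x, u x * 𝓕 ψ x)).sub hlow0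

/-! ### The linear functionals in the Euler–Lagrange equations -/

/-- The pairing of `|u|^p u` with `φ`. -/
def pairLeb (p : ℝ) (u : Space d → ℂ) (φ : 𝓢(Space d, ℂ)) : ℂ :=
  ∫ x, ((‖u x‖ ^ p : ℝ) : ℂ) * u x * φ x

/-- The pairing of `(-Δ)^γ u` with `φ`, where `f` is the Fourier transform of `u`. -/
def pairSob (γ : ℝ) (f : Space d → ℂ) (φ : 𝓢(Space d, ℂ)) : ℂ :=
  ∫ ξ, (wt (2 * γ) ξ : ℂ) * f ξ * 𝓕⁻ φ ξ

theorem pairLeb_smul (p : ℝ) (u : Space d → ℂ) (c : ℂ) (φ : 𝓢(Space d, ℂ)) :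
    pairLeb p u (c • φ) = c * pairLeb p u φ := by
  rw [pairLeb, pairLeb, ← integral_const_mul]
  congr 1 with x
  rw [smul_apply, smul_eq_mul]
  ring

theorem pairSob_smul (γ : ℝ) (f : Space d → ℂ) (c : ℂ) (φ : 𝓢(Space d, ℂ)) :
    pairSob γ f (c • φ) = c * pairSob γ f φ := by
  rw [pairSob, pairSob, ← integral_const_mul]
  congr 1 with x
  rw [FourierTransform.fourierInv_smul, smul_apply, smul_eq_mul]
  ring

/-- Cauchy–Schwarz, with the symbol split evenly between `f` and `ψ`. -/
theorem integrable_wt_mul {γ : ℝ} (hγ : 0 ≤ γ) {f : Space d → ℂ}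
    (hf : MemLp (fun ξ => (wt γ ξ : ℂ) * f ξ) 2 volume) (ψ : 𝓢(Space d, ℂ)) :
    Integrable (fun ξ => (wt (2 * γ) ξ : ℂ) * f ξ * ψ ξ) := by
  refine (hf.integrable_mul (memLp_wt_mul γ hγ 2 ψ)).congr (Eventually.of_forall fun ξ => ?_)
  simp only [Pi.mul_apply, wt_two_mul]
  push_cast
  ring

theorem memLp_norm_rpow_mul {p : ℝ} (hp : 0 < p + 1) {u : Space d → ℂ}
    (hu : MemLp u (ENNReal.ofReal (p + 2)) volume) :
    MemLp (fun x => ((‖u x‖ ^ p : ℝ) : ℂ) * u x)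
      (ENNReal.ofReal ((p + 2) / (p + 1))) volume := by
  have hmeas : AEStronglyMeasurable (fun x => ((‖u x‖ ^ p : ℝ) : ℂ) * u x) volume :=
    (Complex.measurable_ofReal.comp_aemeasurable
      (hu.1.norm.aemeasurable.pow_const p)).aestronglyMeasurable.mul hu.1
  have h := hu.norm_rpow_div (ENNReal.ofReal (p + 1))
  rw [ENNReal.toReal_ofReal hp.le, ← ENNReal.ofReal_div_of_pos hp] at h
  refine h.of_le hmeas (Eventually.of_forall fun x => le_of_eq ?_)
  rw [norm_mul, Complex.norm_real, Real.norm_of_nonneg (by positivity),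
    Real.norm_of_nonneg (by positivity), ← Real.rpow_add_one' (norm_nonneg _) hp.ne']

theorem integrable_norm_rpow_mul {p : ℝ} (hp : 0 < p + 1) {u : Space d → ℂ}
    (hu : MemLp u (ENNReal.ofReal (p + 2)) volume) (φ : 𝓢(Space d, ℂ)) :
    Integrable (fun x => ((‖u x‖ ^ p : ℝ) : ℂ) * u x * φ x) :=
  integrable_mul_schwartz ((one_lt_div hp).2 (by linarith)) (memLp_norm_rpow_mul hp hu) φ

theorem IsFourier.integral_mul_bilaplacian {u f : Space d → ℂ} (h : IsFourier u f)
    (φ : 𝓢(Space d, ℂ)) : ∫ x, u x * (Δ (Δ φ)) x = pairSob 2 f φ := by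
  have h1 := (h.2.2 (𝓕⁻ (Δ (Δ φ)))).2.2
  rw [FourierTransform.fourier_fourierInv_eq] at h1
  rw [h1, pairSob]
  congr 1 with ξ
  rw [fourierInv_laplacian_laplacian]
  ring

/-- For functions in `L^p` the Fourier identity extends from test functions vanishing near the
origin to all test functions. -/
theorem IsFourierModPoly.integral_mul_fourier (hd : 1 ≤ d) {u f : Space d → ℂ}
    (h : IsFourierModPoly u f) {p : ℝ} (hp : 1 < p) (hu : MemLp u (ENNReal.ofReal p) volume)
    (ψ : 𝓢(Space d, ℂ)) (hψ : Integrable (fun ξ => f ξ * ψ ξ)) :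
    ∫ x, u x * 𝓕 ψ x = ∫ ξ, f ξ * ψ ξ := by
  obtain ⟨ψn, h1, h2, h3, h4⟩ := exists_approx_vanishing_near_zero hp hu hd ψ
  have hn := fun n => h.2.2 (ψn n) (.of_eventually_eq_zero (h1 n))
  simp only [(hn _).2.2] at h4
  refine tendsto_nhds_unique h4 ?_
  refine tendsto_integral_of_dominated_convergence (fun ξ => ‖f ξ * ψ ξ‖)
    (fun n => (hn n).2.1.1) hψ.norm (fun n => Eventually.of_forall fun ξ => ?_) ?_
  · rw [norm_mul, norm_mul]
    exact mul_le_mul_of_nonneg_left (h2 n ξ) (norm_nonneg _)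
  · filter_upwards [ae_ne_zero hd] with ξ hξ using (h3 ξ hξ).const_mul _

/-- The test function `𝓕⁻ (Δ (Δ φ))` need not be flat at the origin, but its factor `|ξ|⁴` makes the
product with `f` integrable, so the identity extends to it. -/
theorem IsFourierModPoly.integral_mul_bilaplacian (hd : 1 ≤ d) {u f : Space d → ℂ}
    (h : IsFourierModPoly u f) {p : ℝ} (hp : 1 < p) (hu : MemLp u (ENNReal.ofReal p) volume)
    (hf : MemLp (fun ξ => (wt 2 ξ : ℂ) * f ξ) 2 volume) (φ : 𝓢(Space d, ℂ)) :
    ∫ x, u x * (Δ (Δ φ)) x = pairSob 2 f φ := by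
  have e : (fun ξ => f ξ * 𝓕⁻ (Δ (Δ φ)) ξ) = fun ξ => (wt (2 * 2) ξ : ℂ) * f ξ * 𝓕⁻ φ ξ := by
    ext ξ
    rw [fourierInv_laplacian_laplacian]
    ring
  have h1 := h.integral_mul_fourier hd hp hu (𝓕⁻ (Δ (Δ φ)))
    (by rw [e]; exact integrable_wt_mul zero_le_two hf _)
  rw [FourierTransform.fourier_fourierInv_eq, e] at h1
  exact h1

/-- A function in `L^p` whose Fourier transform vanishes away from the origin is zero. -/
theorem IsFourierModPoly.ae_eq_zero (hd : 1 ≤ d) {u f : Space d → ℂ}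
    (h : IsFourierModPoly u f) {p : ℝ} (hp : 1 < p) (hu : MemLp u (ENNReal.ofReal p) volume)
    (hf : ∀ᵐ ξ, f ξ = 0) : ∀ᵐ x, u x = 0 := by
  refine ae_eq_zero_of_integral_schwartz_eq_zero hd fun φ _ =>
    ⟨integrable_mul_schwartz hp hu φ, ?_⟩
  have e : (fun ξ => f ξ * 𝓕⁻ φ ξ) =ᵐ[volume] fun _ => 0 := by
    filter_upwards [hf] with ξ hξ
    simp [hξ]
  have h1 := h.integral_mul_fourier hd hp hu (𝓕⁻ φ) ((integrable_zero _ _ _).congr e.symm)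
  rw [FourierTransform.fourier_fourierInv_eq] at h1
  rw [h1, integral_congr_ae e, integral_zero]

/-! ### First variations -/

theorem re_integral {F : Space d → ℂ} (hF : Integrable F) : (∫ x, F x).re = ∫ x, (F x).re :=
  (integral_re hF).symm

/-- For `|t| ≤ 1` the integrand's derivative is bounded by `p |u + tv|^{p-1} |v| ≤ p (|u| + |v|)^p`,
which is integrable; `p > 1` ensures differentiability at zeros too. -/
theorem hasDerivAt_integral_norm_rpow {p : ℝ} (hp : 1 < p) {u v : Space d → ℂ}
    (hu : MemLp u (ENNReal.ofReal p) volume) (hv : MemLp v (ENNReal.ofReal p) volume) :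
    HasDerivAt (fun t : ℝ => ∫ x, ‖u x + t * v x‖ ^ p)
      (p * ∫ x, ((((‖u x‖ ^ (p - 2) : ℝ) : ℂ) * u x * conj (v x)).re)) 0 := by
  have hp0 : 0 < p := by linarith
  have hint : ∀ w : Space d → ℂ, MemLp w (ENNReal.ofReal p) volume →
      Integrable (fun x => ‖w x‖ ^ p) := fun w hw => by
    simpa [ENNReal.toReal_ofReal hp0.le] using
      hw.integrable_norm_rpow (by simpa using hp0) ENNReal.ofReal_ne_top
  have hmeas : ∀ t : ℝ, AEStronglyMeasurable (fun x => u x + t * v x) volume := fun t =>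
    hu.1.add (hv.1.const_mul _)
  let F' : ℝ → Space d → ℝ := fun t x =>
    p * ‖u x + t * v x‖ ^ (p - 2) * inner ℝ (u x + t * v x) (v x)
  have key := hasDerivAt_integral_of_dominated_loc_of_deriv_le (μ := volume)
    (F := fun (t : ℝ) x => ‖u x + t * v x‖ ^ p) (F' := F') (x₀ := (0 : ℝ))
    (s := Metric.ball 0 1) (bound := fun x => p * ‖(‖u x‖ + ‖v x‖ : ℝ)‖ ^ p)
    (Metric.ball_mem_nhds 0 one_pos)
    (Eventually.of_forall fun t =>
      ((hmeas t).norm.aemeasurable.pow_const p).aestronglyMeasurable)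
    (by simpa using hint u hu)
    ((((hmeas 0).norm.aemeasurable.pow_const (p - 2)).const_mul p).aestronglyMeasurable.mul
      ((hmeas 0).inner hv.1))
    (Eventually.of_forall fun x t ht => ?_)
    ?_ (Eventually.of_forall fun x t _ => ?_)
  · refine key.2.congr_deriv ?_
    rw [← integral_const_mul]
    congr 1 with x
    simp only [F', Complex.ofReal_zero, zero_mul, add_zero, mul_assoc]
    congr 1
    rw [Complex.re_ofReal_mul, Complex.inner]
    simp [mul_comm]
  · have ht' : |t| ≤ 1 := by simpa using (Metric.mem_ball.1 ht).le
    have h1 : ‖u x + t * v x‖ ≤ ‖u x‖ + ‖v x‖ := by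
      refine (norm_add_le _ _).trans (add_le_add_right ?_ _)
      rw [norm_mul, Complex.norm_real, Real.norm_eq_abs]
      exact mul_le_of_le_one_left (norm_nonneg _) ht'
    have h2 : ‖v x‖ ≤ ‖u x‖ + ‖v x‖ := by linarith [norm_nonneg (u x)]
    have h3 : ‖u x + t * v x‖ ^ (p - 2) * ‖u x + t * v x‖ = ‖u x + t * v x‖ ^ (p - 1) := by
      rw [← Real.rpow_add_one' (norm_nonneg _) (by linarith)]; ring_nf
    have h4 : (‖u x‖ + ‖v x‖) ^ p = (‖u x‖ + ‖v x‖) ^ (p - 1) * (‖u x‖ + ‖v x‖) := by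
      rw [← Real.rpow_add_one' (by positivity) (by linarith)]; ring_nf
    rw [Real.norm_of_nonneg (by positivity : 0 ≤ ‖u x‖ + ‖v x‖), h4, norm_mul, norm_mul,
      Real.norm_of_nonneg hp0.le, Real.norm_of_nonneg (by positivity), mul_assoc]
    refine mul_le_mul_of_nonneg_left ?_ hp0.le
    calc _ ≤ ‖u x + t * v x‖ ^ (p - 2) * (‖u x + t * v x‖ * ‖v x‖) :=
          mul_le_mul_of_nonneg_left (norm_inner_le_norm _ _) (by positivity)
      _ = ‖u x + t * v x‖ ^ (p - 1) * ‖v x‖ := by rw [← h3, mul_assoc]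
      _ ≤ _ := mul_le_mul (Real.rpow_le_rpow (norm_nonneg _) h1 (by linarith)) h2
          (norm_nonneg _) (by positivity)
  · have hs : MemLp (fun x => ‖u x‖ + ‖v x‖) (ENNReal.ofReal p) volume := hu.norm.add hv.norm
    have := hs.integrable_norm_rpow (by simpa using hp0) ENNReal.ofReal_ne_top
    rw [ENNReal.toReal_ofReal hp0.le] at this
    exact this.const_mul p
  · have h1 : HasDerivAt (fun t : ℝ => u x + t * v x) (v x) t := by
      simpa using ((hasDerivAt_id t).ofReal_comp.mul_const (v x)).const_add (u x)
    have h2 := (hasFDerivAt_norm_rpow (u x + t * v x) hp).comp_hasDerivAt t h1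
    refine h2.congr_deriv ?_
    simp only [F', _root_.smul_apply, innerSL_apply_apply, smul_eq_mul]

/-- The perturbation is by the conjugate of `φ` because the derivative pairs with the conjugate of
the direction, whereas `pairLeb` is linear in `φ`. -/
theorem hasDerivAt_integral_norm_rpow_schwartz {p : ℝ} (hp : 2 < p) {u : Space d → ℂ}
    (hu : MemLp u (ENNReal.ofReal p) volume) (φ : 𝓢(Space d, ℂ)) :
    HasDerivAt (fun t : ℝ => ∫ x, ‖u x + t * conjSchwartz φ x‖ ^ p)
      (p * (pairLeb (p - 2) u φ).re) 0 := by
  refine (hasDerivAt_integral_norm_rpow (by linarith) hu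
    ((conjSchwartz φ).memLp _ volume)).congr_deriv ?_
  simp only [conjSchwartz_apply, Complex.conj_conj]
  rw [pairLeb, re_integral]
  exact integrable_norm_rpow_mul (by linarith) (by simpa using hu) φ

theorem hasDerivAt_integral_sq_norm_wt {γ : ℝ} (hγ : 0 ≤ γ) {f : Space d → ℂ}
    (hf : MemLp (fun ξ => (wt γ ξ : ℂ) * f ξ) 2 volume) (φ : 𝓢(Space d, ℂ)) :
    HasDerivAt (fun t : ℝ => ∫ ξ, ‖(wt γ ξ : ℂ) * (f ξ + t * 𝓕 (conjSchwartz φ) ξ)‖ ^ 2)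
      (2 * (pairSob γ f φ).re) 0 := by
  have h := hasDerivAt_integral_norm_rpow one_lt_two
    (u := fun ξ => (wt γ ξ : ℂ) * f ξ) (v := fun ξ => (wt γ ξ : ℂ) * 𝓕 (conjSchwartz φ) ξ)
    (by simpa using hf) (by simpa using memLp_wt_mul γ hγ 2 (𝓕 (conjSchwartz φ)))
  convert h using 2
  · congr 1 with ξ
    rw [Real.rpow_two, mul_add]
    congr 2
    ring
  · rw [pairSob, re_integral (integrable_wt_mul hγ hf _)]
    congr 1 with ξ
    simp only [sub_self, Real.rpow_zero, Complex.ofReal_one, one_mul, map_mul, Complex.conj_ofReal,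
      conj_fourier_conjSchwartz, wt_two_mul]
    push_cast
    congr 1
    ring

/-- The first variation of `N / (B ^ κ * D)` vanishes at a maximum. -/
theorem deriv_quotient_eq_of_max {N B D : ℝ → ℝ} {N' B' D' κ : ℝ} (hN : HasDerivAt N N' 0)
    (hB : HasDerivAt B B' 0) (hD : HasDerivAt D D' 0) (hN0 : 0 < N 0) (hB0 : 0 < B 0)
    (hD0 : 0 < D 0) (hmax : ∀ t, N t / (B t ^ κ * D t) ≤ N 0 / (B 0 ^ κ * D 0)) :
    N' / N 0 - κ * (B' / B 0) - D' / D 0 = 0 := by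
  have hder := ((hN.log hN0.ne').sub ((hB.log hB0.ne').const_mul κ)).sub (hD.log hD0.ne')
  -- Near `0` all three functions are positive, so the logarithm of the quotient is defined and
  -- inherits the maximum.
  refine IsLocalMax.hasDerivAt_eq_zero (f := fun t =>
    Real.log (N t) - κ * Real.log (B t) - Real.log (D t)) ?_ hder
  filter_upwards [hN.continuousAt.eventually_const_lt hN0,
    hB.continuousAt.eventually_const_lt hB0, hD.continuousAt.eventually_const_lt hD0]
    with t h1 h2 h3
  have e : ∀ s, 0 < N s → 0 < B s → 0 < D s →
      Real.log (N s) - κ * Real.log (B s) - Real.log (D s) =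
        Real.log (N s / (B s ^ κ * D s)) := by
    intro s a b c
    have := Real.rpow_pos_of_pos b κ
    rw [Real.log_div a.ne' (by positivity), Real.log_mul this.ne' c.ne', Real.log_rpow b]
    ring
  rw [e t h1 h2 h3, e 0 hN0 hB0 hD0]
  have := Real.rpow_pos_of_pos h2 κ
  exact Real.log_le_log (by positivity) (hmax t)

/-! ### The exponents -/

theorem Intercritical.mul_lt {α : ℝ} (hd : 1 ≤ d) (h : Intercritical d α) :
    0 < α ∧ 8 < d * α ∧ ((d : ℝ) - 4) * α < 8 := by
  have hd' : (0 : ℝ) < d := by exact_mod_cast hd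
  have h1 : 8 < d * α := by
    have := h.1
    rw [div_lt_iff₀ hd'] at this
    linarith
  have hα : 0 < α := lt_trans (by positivity) h.1
  refine ⟨hα, h1, ?_⟩
  by_cases h5 : 5 ≤ d
  · have h5' : (5 : ℝ) ≤ d := by exact_mod_cast h5
    have := h.2 h5
    rw [lt_div_iff₀ (by linarith)] at this
    linarith
  · have h5' : (d : ℝ) ≤ 4 := by exact_mod_cast (by omega : d ≤ 4)
    nlinarith

theorem Intercritical.critSobolevExp_pos {α : ℝ} (hd : 1 ≤ d) (h : Intercritical d α) :
    0 < critSobolevExp d α := by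
  obtain ⟨h0, h1, -⟩ := h.mul_lt hd
  rw [critSobolevExp, sub_pos, div_lt_div_iff₀ h0 two_pos]
  linarith

theorem Intercritical.critSobolevExp_lt {α : ℝ} (hd : 1 ≤ d) (h : Intercritical d α) :
    critSobolevExp d α < 2 := by
  obtain ⟨h0, -, h2⟩ := h.mul_lt hd
  have : (d : ℝ) / 2 - 2 < 4 / α := by
    rw [lt_div_iff₀ h0]
    linarith
  rw [critSobolevExp]
  linarith

theorem Intercritical.two_lt_critLebesgueExp {α : ℝ} (hd : 1 ≤ d) (h : Intercritical d α) :
    2 < critLebesgueExp d α := by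
  obtain ⟨-, h1, -⟩ := h.mul_lt hd
  rw [critLebesgueExp]
  linarith

theorem Intercritical.critLebesgueExp_lt {α : ℝ} (hd : 1 ≤ d) (h : Intercritical d α) :
    critLebesgueExp d α < α + 2 := by
  obtain ⟨-, -, h2⟩ := h.mul_lt hd
  rw [critLebesgueExp]
  linarith

/-! ### Vanishing of norms -/

/-- For `s ≠ 0` the symbol is an injective function of `|ξ|`, so each level set lies in one sphere.
-/
theorem ae_wt_ne (hd : 1 ≤ d) {s : ℝ} (hs : s ≠ 0) (k : ℝ) : ∀ᵐ ξ : Space d, wt s ξ ≠ k := by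
  have : Nonempty (Fin d) := ⟨⟨0, hd⟩⟩
  have hnull : volume (Metric.sphere (0 : Space d) (k ^ s⁻¹ / (2 * Real.pi))) = 0 :=
    Measure.addHaar_sphere _ _ _
  filter_upwards [measure_eq_zero_iff_ae_notMem.1 hnull] with ξ hξ hk
  refine hξ (mem_sphere_zero_iff_norm.2 ?_)
  rw [← hk, wt, Real.rpow_rpow_inv (by positivity) hs]
  field_simp

theorem hdotNorm_eq_zero_iff (hd : 1 ≤ d) {u f : Space d → ℂ} (hf : IsFourierModPoly u f)
    (γ : ℝ) : hdotNorm γ u = 0 ↔ ∀ᵐ ξ, f ξ = 0 := by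
  have hmeas : AEStronglyMeasurable (fun ξ => (wt γ ξ : ℂ) * f ξ) volume :=
    (Complex.measurable_ofReal.comp (measurable_wt γ)).aestronglyMeasurable.mul hf.2.1
  rw [hdotNorm_eq hd hf, eLpNorm_eq_zero_iff hmeas two_ne_zero]
  constructor
  · intro h
    filter_upwards [h, ae_ne_zero hd] with ξ h1 h2
    have h3 : (wt γ ξ : ℂ) ≠ 0 := by exact_mod_cast (wt_pos γ h2).ne'
    simpa [h3] using h1
  · intro h
    filter_upwards [h] with ξ h1
    simp [h1]

theorem lebNorm_eq_zero_iff {p : ℝ} (hp : 0 < p) {u : Space d → ℂ}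
    (hu : AEStronglyMeasurable u volume) : lebNorm p u = 0 ↔ ∀ᵐ x, u x = 0 := by
  rw [lebNorm, eLpNorm_eq_zero_iff hu (by simpa using hp)]
  rfl

/-- There is a Schwartz function that is not almost everywhere zero. -/
theorem exists_schwartz_ne_zero : ∃ φ : 𝓢(Space d, ℂ), ¬ ∀ᵐ x, φ x = 0 := by
  let b : ContDiffBump (0 : Space d) := ⟨1, 2, one_pos, one_lt_two⟩
  have hbc : HasCompactSupport (fun ξ => (b ξ : ℂ)) :=
    b.hasCompactSupport.comp_left (g := Complex.ofReal) Complex.ofReal_zero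
  refine ⟨hbc.toSchwartzMap (Complex.ofRealCLM.contDiff.comp b.contDiff), fun h => ?_⟩
  have h1 := Continuous.ae_eq_iff_eq volume (SchwartzMap.continuous _) continuous_const |>.1 h
  have h2 := congrFun h1 0
  have h3 : ((b 0 : ℝ) : ℂ) = 0 := h2
  rw [b.one_of_mem_closedBall (Metric.mem_closedBall_self zero_le_one)] at h3
  simp at h3

theorem hdotNorm_schwartz_lt_top (hd : 1 ≤ d) {γ : ℝ} (hγ : 0 ≤ γ) (φ : 𝓢(Space d, ℂ)) :
    hdotNorm γ φ < ⊤ := by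
  rw [hdotNorm_eq hd (isFourier_schwartz φ).modPoly]
  exact (memLp_wt_mul γ hγ 2 (𝓕 φ)).2

theorem hdotNorm_schwartz_ne_zero (hd : 1 ≤ d) (γ : ℝ) {φ : 𝓢(Space d, ℂ)}
    (hφ : ¬ ∀ᵐ x, φ x = 0) : hdotNorm γ φ ≠ 0 := by
  rw [Ne, hdotNorm_eq_zero_iff hd (isFourier_schwartz φ).modPoly]
  exact fun h => hφ ((isFourier_schwartz φ).modPoly.ae_eq_zero hd one_lt_two (φ.memLp _) h)

theorem toReal_lebNorm_schwartz_pos {p : ℝ} (hp : 0 < p) {φ : 𝓢(Space d, ℂ)}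
    (hφ : ¬ ∀ᵐ x, φ x = 0) : 0 < (lebNorm p φ).toReal := by
  refine ENNReal.toReal_pos ?_ (φ.memLp (ENNReal.ofReal p) volume).2.ne
  rwa [Ne, lebNorm_eq_zero_iff hp φ.continuous.aestronglyMeasurable]

theorem toReal_hdotNorm_schwartz_pos (hd : 1 ≤ d) {γ : ℝ} (hγ : 0 ≤ γ) {φ : 𝓢(Space d, ℂ)}
    (hφ : ¬ ∀ᵐ x, φ x = 0) : 0 < (hdotNorm γ φ).toReal :=
  ENNReal.toReal_pos (hdotNorm_schwartz_ne_zero hd γ hφ) (hdotNorm_schwartz_lt_top hd hγ φ).ne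

/-- `ENNReal.toReal` sends `∞` to `0`, so positivity contains finiteness. -/
theorem memLp_of_toReal_lebNorm_pos {p : ℝ} {u : Space d → ℂ}
    (hu : AEStronglyMeasurable u volume) (h : 0 < (lebNorm p u).toReal) :
    MemLp u (ENNReal.ofReal p) volume :=
  ⟨hu, (ENNReal.toReal_pos_iff.1 h).2⟩

theorem eq_zero_of_re_eq_zero {z : ℂ} (h1 : z.re = 0) (h2 : (Complex.I * z).re = 0) : z = 0 := by
  refine Complex.ext h1 ?_
  simpa using h2

theorem pos_of_quotient_pos {a b c p q : ℝ} (ha : 0 ≤ a) (hb : 0 ≤ b) (hc : 0 ≤ c) (hp : 0 < p)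
    (hq : 0 < q) (h : 0 < a ^ p / (b ^ q * c ^ 2)) : 0 < a ∧ 0 < b ∧ 0 < c := by
  refine ⟨ha.lt_of_ne ?_, hb.lt_of_ne ?_, hc.lt_of_ne ?_⟩ <;> rintro rfl <;>
    simp [Real.zero_rpow, hp.ne', hq.ne'] at h

/-! ### Maximizers of `H` -/

section Sobolev

variable {α : ℝ}

theorem sobolevSpace_add_schwartz (hd : 1 ≤ d) (hα : Intercritical d α) {u f : Space d → ℂ}
    (hu : u ∈ sobolevSpace d α) (hf : IsFourier u f) (t : ℂ) (φ : 𝓢(Space d, ℂ)) :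
    (fun x => u x + t * φ x) ∈ sobolevSpace d α := by
  have aux : ∀ γ : ℝ, 0 ≤ γ → hdotNorm γ u < ⊤ →
      hdotNorm γ (fun x => u x + t * φ x) < ⊤ := by
    intro γ hγ h
    rw [hdotNorm_eq hd (hf.add_schwartz t φ).modPoly]
    have h1 := memLp_of_hdotNorm_lt_top hd hf.modPoly h
    have h2 := (memLp_wt_mul γ hγ 2 (𝓕 φ)).const_mul t
    refine lt_of_eq_of_lt (congrArg (fun F => eLpNorm F 2 volume) ?_) (h1.add h2).2
    ext ξ
    simp only [Pi.add_apply]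
    ring
  exact ⟨⟨_, hf.add_schwartz t φ⟩, aux _ (hα.critSobolevExp_pos hd).le hu.2.1,
    aux 2 zero_le_two hu.2.2⟩

/-- A maximizer does at least as well as a nonzero Schwartz function, whose quotient is positive. As
`∞.toReal` and `x / 0` are both `0`, this yields nontriviality and membership in `L^{α+2}` together.
-/
theorem functionalH_pos_of_isMaxOn (hd : 1 ≤ d) (hα : Intercritical d α) {u : Space d → ℂ}
    (hmax : IsMaxOn (functionalH α) (sobolevSpace d α) u) :
    0 < (lebNorm (α + 2) u).toReal ∧ 0 < (hdotNorm (critSobolevExp d α) u).toReal ∧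
      0 < (hdotNorm 2 u).toReal := by
  have hα0 := (hα.mul_lt hd).1
  obtain ⟨φ, hφ⟩ := exists_schwartz_ne_zero (d := d)
  have hγ := (hα.critSobolevExp_pos hd).le
  have hmem : (φ : Space d → ℂ) ∈ sobolevSpace d α := ⟨⟨_, isFourier_schwartz φ⟩,
    hdotNorm_schwartz_lt_top hd hγ φ, hdotNorm_schwartz_lt_top hd zero_le_two φ⟩
  have hpos : 0 < functionalH α (φ : Space d → ℂ) := by
    have h1 := toReal_lebNorm_schwartz_pos (p := α + 2) (by linarith) hφ
    have h2 := toReal_hdotNorm_schwartz_pos hd hγ hφ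
    have h3 := toReal_hdotNorm_schwartz_pos hd zero_le_two hφ
    unfold functionalH
    positivity
  exact pos_of_quotient_pos ENNReal.toReal_nonneg ENNReal.toReal_nonneg ENNReal.toReal_nonneg
    (by linarith) hα0 (hpos.trans_le (hmax hmem))

/-- The Euler–Lagrange equation of a maximizer of `H`. -/
theorem eulerLagrange_functionalH (hd : 1 ≤ d) (hα : Intercritical d α) {u f : Space d → ℂ}
    (hu : u ∈ sobolevSpace d α) (hf : IsFourier u f)
    (hmax : IsMaxOn (functionalH α) (sobolevSpace d α) u) (φ : 𝓢(Space d, ℂ)) :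
    (((α + 2) / (lebNorm (α + 2) u).toReal ^ (α + 2) : ℝ) : ℂ) * pairLeb α u φ
      - ((α / (hdotNorm (critSobolevExp d α) u).toReal ^ 2 : ℝ) : ℂ) *
        pairSob (critSobolevExp d α) f φ
      - ((2 / (hdotNorm 2 u).toReal ^ 2 : ℝ) : ℂ) * pairSob 2 f φ = 0 := by
  have hα0 := (hα.mul_lt hd).1
  have hγ := (hα.critSobolevExp_pos hd).le
  obtain ⟨hA, hB, hC⟩ := functionalH_pos_of_isMaxOn hd hα hmax
  set γ := critSobolevExp d α with hγdef
  have hLp : MemLp u (ENNReal.ofReal (α + 2)) volume := memLp_of_toReal_lebNorm_pos hf.1 hA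
  have hF1 := memLp_of_hdotNorm_lt_top hd hf.modPoly hu.2.1
  have hF2 := memLp_of_hdotNorm_lt_top hd hf.modPoly hu.2.2
  have hre : ∀ φ : 𝓢(Space d, ℂ),
      ((((α + 2) / (lebNorm (α + 2) u).toReal ^ (α + 2) : ℝ) : ℂ) * pairLeb α u φ
      - ((α / (hdotNorm γ u).toReal ^ 2 : ℝ) : ℂ) * pairSob γ f φ
      - ((2 / (hdotNorm 2 u).toReal ^ 2 : ℝ) : ℂ) * pairSob 2 f φ).re = 0 := by
    intro φ
    let N : ℝ → ℝ := fun t => ∫ x, ‖u x + t * conjSchwartz φ x‖ ^ (α + 2)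
    let S : ℝ → ℝ → ℝ := fun s t => ∫ ξ, ‖(wt s ξ : ℂ) * (f ξ + t * 𝓕 (conjSchwartz φ) ξ)‖ ^ 2
    have hN : HasDerivAt N ((α + 2) * (pairLeb α u φ).re) 0 := by
      have h := hasDerivAt_integral_norm_rpow_schwartz (p := α + 2) (by linarith) hLp φ
      rwa [add_sub_cancel_right] at h
    have hS1 : HasDerivAt (S γ) (2 * (pairSob γ f φ).re) 0 :=
      hasDerivAt_integral_sq_norm_wt hγ hF1 φ
    have hS2 : HasDerivAt (S 2) (2 * (pairSob 2 f φ).re) 0 :=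
      hasDerivAt_integral_sq_norm_wt zero_le_two hF2 φ
    have hmem : ∀ t : ℝ, (fun x => u x + t * conjSchwartz φ x) ∈ sobolevSpace d α :=
      fun t => sobolevSpace_add_schwartz hd hα hu hf t _
    have hNt : ∀ t : ℝ,
        (lebNorm (α + 2) (fun x => u x + t * conjSchwartz φ x)).toReal ^ (α + 2) = N t :=
      fun t => toReal_lebNorm_rpow (by linarith) (hLp.add (((conjSchwartz φ).memLp _).const_mul _))
    have hSt : ∀ s t : ℝ, hdotNorm s (fun x => u x + t * conjSchwartz φ x) < ⊤ →
        (hdotNorm s (fun x => u x + t * conjSchwartz φ x)).toReal ^ 2 = S s t := fun s t h => by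
      have hft := (hf.add_schwartz t (conjSchwartz φ)).modPoly
      rw [hdotNorm_eq hd hft, sq_toReal_eLpNorm_two (memLp_of_hdotNorm_lt_top hd hft h)]
    -- The differentiable quantity is the squared critical norm, hence the exponent `α / 2`.
    have hval : ∀ t : ℝ, functionalH α (fun x => u x + t * conjSchwartz φ x) =
        N t / (S γ t ^ (α / 2) * S 2 t) := fun t => by
      rw [functionalH, hNt, hSt 2 t (hmem t).2.2, ← hSt γ t (hmem t).2.1,
        ← Real.rpow_natCast_mul ENNReal.toReal_nonneg]
      congr 3
      push_cast
      ring
    have hzero : (fun x => u x + ((0 : ℝ) : ℂ) * conjSchwartz φ x) = u := by ext; simp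
    have h0 := hval 0
    have hN0 := hNt 0
    have hS10 := hSt γ 0 (hmem 0).2.1
    have hS20 := hSt 2 0 (hmem 0).2.2
    rw [hzero] at h0 hN0 hS10 hS20
    have := deriv_quotient_eq_of_max hN hS1 hS2 (κ := α / 2) (hN0 ▸ by positivity)
      (hS10 ▸ by positivity) (hS20 ▸ by positivity)
      (fun t => by rw [← hval t, ← h0]; exact hmax (hmem t))
    rw [Complex.sub_re, Complex.sub_re, Complex.re_ofReal_mul, Complex.re_ofReal_mul,
      Complex.re_ofReal_mul, ← this, hN0, hS10, hS20]
    ring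
  refine eq_zero_of_re_eq_zero (hre φ) ?_
  -- Testing with `iφ` recovers the imaginary part.
  have h := hre (Complex.I • φ)
  rw [pairLeb_smul, pairSob_smul, pairSob_smul] at h
  rw [← h]
  congr 1
  ring

end Sobolev

/-! ### Maximizers of `K` -/

section Lebesgue

variable {α : ℝ}

theorem lebesgueSpace_add_schwartz (hd : 1 ≤ d) {u f : Space d → ℂ}
    (hu : u ∈ lebesgueSpace d α) (hf : IsFourierModPoly u f) (t : ℂ) (φ : 𝓢(Space d, ℂ)) :
    (fun x => u x + t * φ x) ∈ lebesgueSpace d α := by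
  refine ⟨hu.1.add ((φ.memLp _).const_mul t), ?_⟩
  rw [hdotNorm_eq hd (hf.add_schwartz t φ)]
  have h1 := memLp_of_hdotNorm_lt_top hd hf hu.2
  have h2 := (memLp_wt_mul 2 zero_le_two 2 (𝓕 φ)).const_mul t
  refine lt_of_eq_of_lt (congrArg (fun F => eLpNorm F 2 volume) ?_) (h1.add h2).2
  ext ξ
  simp only [Pi.add_apply]
  ring

theorem functionalK_pos_of_isMaxOn (hd : 1 ≤ d) (hα : Intercritical d α) {u : Space d → ℂ}
    (hmax : IsMaxOn (functionalK α) (lebesgueSpace d α) u) :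
    0 < (lebNorm (α + 2) u).toReal ∧ 0 < (lebNorm (critLebesgueExp d α) u).toReal ∧
      0 < (hdotNorm 2 u).toReal := by
  have hα0 := (hα.mul_lt hd).1
  have hq := hα.two_lt_critLebesgueExp hd
  obtain ⟨φ, hφ⟩ := exists_schwartz_ne_zero (d := d)
  have hmem : (φ : Space d → ℂ) ∈ lebesgueSpace d α :=
    ⟨φ.memLp _, hdotNorm_schwartz_lt_top hd zero_le_two φ⟩
  have hpos : 0 < functionalK α (φ : Space d → ℂ) := by
    have h1 := toReal_lebNorm_schwartz_pos (p := α + 2) (by linarith) hφ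
    have h2 := toReal_lebNorm_schwartz_pos (p := critLebesgueExp d α) (by linarith) hφ
    have h3 := toReal_hdotNorm_schwartz_pos hd zero_le_two hφ
    unfold functionalK
    positivity
  exact pos_of_quotient_pos ENNReal.toReal_nonneg ENNReal.toReal_nonneg ENNReal.toReal_nonneg
    (by linarith) hα0 (hpos.trans_le (hmax hmem))

/-- The Euler–Lagrange equation of a maximizer of `K`. -/
theorem eulerLagrange_functionalK (hd : 1 ≤ d) (hα : Intercritical d α) {u f : Space d → ℂ}
    (hu : u ∈ lebesgueSpace d α) (hf : IsFourierModPoly u f)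
    (hmax : IsMaxOn (functionalK α) (lebesgueSpace d α) u) (φ : 𝓢(Space d, ℂ)) :
    (((α + 2) / (lebNorm (α + 2) u).toReal ^ (α + 2) : ℝ) : ℂ) * pairLeb α u φ
      - ((α / (lebNorm (critLebesgueExp d α) u).toReal ^ (critLebesgueExp d α) : ℝ) : ℂ) *
        pairLeb (critLebesgueExp d α - 2) u φ
      - ((2 / (hdotNorm 2 u).toReal ^ 2 : ℝ) : ℂ) * pairSob 2 f φ = 0 := by
  have hα0 := (hα.mul_lt hd).1
  have hq := hα.two_lt_critLebesgueExp hd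
  obtain ⟨hA, hB, hC⟩ := functionalK_pos_of_isMaxOn hd hα hmax
  have huq := hu.1
  set q := critLebesgueExp d α with hqdef
  have hLp : MemLp u (ENNReal.ofReal (α + 2)) volume := memLp_of_toReal_lebNorm_pos hf.1 hA
  have hF2 := memLp_of_hdotNorm_lt_top hd hf hu.2
  have hre : ∀ φ : 𝓢(Space d, ℂ),
      ((((α + 2) / (lebNorm (α + 2) u).toReal ^ (α + 2) : ℝ) : ℂ) * pairLeb α u φ
      - ((α / (lebNorm q u).toReal ^ q : ℝ) : ℂ) * pairLeb (q - 2) u φ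
      - ((2 / (hdotNorm 2 u).toReal ^ 2 : ℝ) : ℂ) * pairSob 2 f φ).re = 0 := by
    intro φ
    let N : ℝ → ℝ → ℝ := fun p t => ∫ x, ‖u x + t * conjSchwartz φ x‖ ^ p
    let S : ℝ → ℝ := fun t => ∫ ξ, ‖(wt 2 ξ : ℂ) * (f ξ + t * 𝓕 (conjSchwartz φ) ξ)‖ ^ 2
    have hN : HasDerivAt (N (α + 2)) ((α + 2) * (pairLeb α u φ).re) 0 := by
      have h := hasDerivAt_integral_norm_rpow_schwartz (p := α + 2) (by linarith) hLp φ
      rwa [add_sub_cancel_right] at h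
    have hN' : HasDerivAt (N q) (q * (pairLeb (q - 2) u φ).re) 0 :=
      hasDerivAt_integral_norm_rpow_schwartz hq huq φ
    have hS : HasDerivAt S (2 * (pairSob 2 f φ).re) 0 :=
      hasDerivAt_integral_sq_norm_wt zero_le_two hF2 φ
    have hmem : ∀ t : ℝ, (fun x => u x + t * conjSchwartz φ x) ∈ lebesgueSpace d α :=
      fun t => lebesgueSpace_add_schwartz hd hu hf t _
    have hNt : ∀ p t : ℝ, 0 < p → MemLp u (ENNReal.ofReal p) volume →
        (lebNorm p (fun x => u x + t * conjSchwartz φ x)).toReal ^ p = N p t :=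
      fun p t hp h => toReal_lebNorm_rpow hp (h.add (((conjSchwartz φ).memLp _).const_mul _))
    have hSt : ∀ t : ℝ,
        (hdotNorm 2 (fun x => u x + t * conjSchwartz φ x)).toReal ^ 2 = S t := fun t => by
      have hft := hf.add_schwartz t (conjSchwartz φ)
      rw [hdotNorm_eq hd hft, sq_toReal_eLpNorm_two (memLp_of_hdotNorm_lt_top hd hft (hmem t).2)]
    -- With the `q`-th power of the norm in the denominator the exponent is `α / q`, which cancels
    -- the factor `q` produced by differentiation.
    have hval : ∀ t : ℝ, functionalK α (fun x => u x + t * conjSchwartz φ x) =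
        N (α + 2) t / (N q t ^ (α / q) * S t) := fun t => by
      rw [functionalK, hNt _ _ (by linarith) hLp, hSt t, ← hNt q t (by linarith) huq,
        ← Real.rpow_mul ENNReal.toReal_nonneg, mul_div_cancel₀ _ (by linarith : q ≠ 0)]
    have hzero : (fun x => u x + ((0 : ℝ) : ℂ) * conjSchwartz φ x) = u := by ext; simp
    have h0 := hval 0
    have hN0 := hNt (α + 2) 0 (by linarith) hLp
    have hN0' := hNt q 0 (by linarith) huq
    have hS0 := hSt 0
    rw [hzero] at h0 hN0 hN0' hS0
    have := deriv_quotient_eq_of_max hN hN' hS (κ := α / q) (hN0 ▸ by positivity)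
      (hN0' ▸ by positivity) (hS0 ▸ by positivity)
      (fun t => by rw [← hval t, ← h0]; exact hmax (hmem t))
    rw [Complex.sub_re, Complex.sub_re, Complex.re_ofReal_mul, Complex.re_ofReal_mul,
      Complex.re_ofReal_mul, ← this, hN0, hN0', hS0]
    have hq0 : q ≠ 0 := by linarith
    field_simp
  refine eq_zero_of_re_eq_zero (hre φ) ?_
  have h := hre (Complex.I • φ)
  rw [pairLeb_smul, pairLeb_smul, pairSob_smul] at h
  rw [← h]
  congr 1
  ring

end Lebesgue

variable {α : ℝ}

/-! ### Ground states -/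

/-- If all three coefficients of the Euler–Lagrange equation agree, the quotient is determined by
the critical norm. -/
theorem quotient_eq {A B C a : ℝ} (hA : 0 < A) (hC : 0 < C) (h : (a + 2) / A = 2 / C) :
    A / (B * C) = (a + 2) / 2 / B := by
  rw [div_eq_div_iff hA.ne' hC.ne'] at h
  have : A = (a + 2) / 2 * C := by linarith
  rw [this, mul_div_mul_right _ _ hC.ne']

theorem pairSob_fourier (γ : ℝ) (f : Space d → ℂ) (ψ : 𝓢(Space d, ℂ)) :
    pairSob γ f (𝓕 ψ) = ∫ ξ, (wt (2 * γ) ξ : ℂ) * f ξ * ψ ξ := by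
  rw [pairSob, FourierTransform.fourierInv_fourier_eq]

/-- The conclusion amounts to `E(g) = 0`. Eliminating the nonlinear term between the two equations
leaves `((a - c)(2π|ξ|)⁴ + (a - b)(2π|ξ|)^{2γ}) f = 0`. If `a ≠ c`, then since `γ < 2` the bracket
vanishes almost nowhere, so `f = 0`, contradicting the positive `Ḣ²` norm. -/
theorem coeff_eq_of_sobolevGroundState (hd : 1 ≤ d) (hα : Intercritical d α) {g : Space d → ℂ}
    (hg : g ∈ sobolevGroundStates d α) :
    (α + 2) / (lebNorm (α + 2) g).toReal ^ (α + 2) = 2 / (hdotNorm 2 g).toReal ^ 2 := by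
  obtain ⟨hmem, hmax, f, hf, heq⟩ := hg
  obtain ⟨hA, hB, hC⟩ := functionalH_pos_of_isMaxOn hd hα hmax
  have hEL := eulerLagrange_functionalH hd hα hmem hf hmax
  have hγ := hα.critSobolevExp_pos hd
  have hγ2 := hα.critSobolevExp_lt hd
  have hF1 := memLp_of_hdotNorm_lt_top hd hf.modPoly hmem.2.1
  have hF2 := memLp_of_hdotNorm_lt_top hd hf.modPoly hmem.2.2
  set a := (α + 2) / (lebNorm (α + 2) g).toReal ^ (α + 2)
  set b := α / (hdotNorm (critSobolevExp d α) g).toReal ^ 2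
  set c := 2 / (hdotNorm 2 g).toReal ^ 2
  set γ := critSobolevExp d α
  have hlin : ∀ φ, ((a - c : ℝ) : ℂ) * pairSob 2 f φ + ((a - b : ℝ) : ℂ) * pairSob γ f φ = 0 := by
    intro φ
    have h1 : pairSob 2 f φ + pairSob γ f φ - pairLeb α g φ = 0 := by
      rw [← hf.integral_mul_bilaplacian φ]; exact heq φ
    have h2 := hEL φ
    push_cast
    linear_combination (a : ℂ) * h1 + h2
  have hae := ae_eq_zero_of_integral_schwartz_eq_zero hd (F := fun ξ =>
      ((a - c : ℝ) : ℂ) * ((wt (2 * 2) ξ : ℂ) * f ξ) +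
        ((a - b : ℝ) : ℂ) * ((wt (2 * γ) ξ : ℂ) * f ξ)) (by
    intro ψ _
    have i1 := (integrable_wt_mul zero_le_two hF2 ψ).const_mul ((a - c : ℝ) : ℂ)
    have i2 := (integrable_wt_mul hγ.le hF1 ψ).const_mul ((a - b : ℝ) : ℂ)
    simp only [add_mul, mul_assoc] at i1 i2 ⊢
    refine ⟨i1.add i2, ?_⟩
    rw [integral_add i1 i2, integral_const_mul, integral_const_mul, ← hlin (𝓕 ψ), pairSob_fourier,
      pairSob_fourier]
    simp only [mul_assoc])
  by_contra hne
  have hne' : a - c ≠ 0 := sub_ne_zero.2 hne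
  have hf0 : ∀ᵐ ξ, f ξ = 0 := by
    filter_upwards [hae, ae_ne_zero hd,
      ae_wt_ne hd (s := 2 * 2 - 2 * γ) (by linarith) (-(a - b) / (a - c))] with ξ h1 h2 h3
    by_contra hfξ
    have hw : wt (2 * 2) ξ = wt (2 * 2 - 2 * γ) ξ * wt (2 * γ) ξ := by
      have := norm_pos_iff.2 h2
      rw [wt, wt, wt, ← Real.rpow_add (by positivity)]
      congr 1
      ring
    have h4 : (((a - c) * wt (2 * 2) ξ + (a - b) * wt (2 * γ) ξ : ℝ) : ℂ) * f ξ = 0 := by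
      rw [← h1]; push_cast; ring
    have h5 : (a - c) * wt (2 * 2) ξ + (a - b) * wt (2 * γ) ξ = 0 := by
      exact_mod_cast (mul_eq_zero.1 h4).resolve_right hfξ
    rw [hw, ← mul_assoc, ← add_mul] at h5
    have h6 := (mul_eq_zero.1 h5).resolve_right (wt_pos _ h2).ne'
    refine h3 ?_
    rw [eq_div_iff hne']
    linarith
  rw [(hdotNorm_eq_zero_iff hd hf.modPoly 2).2 hf0] at hC
  simp at hC

theorem functionalH_sobolevGroundState (hd : 1 ≤ d) (hα : Intercritical d α) {g : Space d → ℂ}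
    (hg : g ∈ sobolevGroundStates d α) :
    functionalH α g = (α + 2) / 2 / (hdotNorm (critSobolevExp d α) g).toReal ^ α := by
  obtain ⟨hA, -, hC⟩ := functionalH_pos_of_isMaxOn hd hα hg.2.1
  exact quotient_eq (by positivity) (by positivity) (coeff_eq_of_sobolevGroundState hd hα hg)

theorem eq_of_div_rpow_eq {a b k : ℝ} (ha : 0 < a) (hb : 0 < b) (hα : 0 < α) (hk : k ≠ 0)
    (h : k / a ^ α = k / b ^ α) : a = b := by
  have ha' := Real.rpow_pos_of_pos ha α
  have hb' := Real.rpow_pos_of_pos hb α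
  rw [div_eq_div_iff ha'.ne' hb'.ne'] at h
  exact (Real.rpow_left_inj ha.le hb.le hα.ne').1 (mul_left_cancel₀ hk h).symm

/-- Two maximizers share the value of `H`, and for ground states this value determines the critical
norm. -/
theorem hdotNorm_sobolevGroundState (hd : 1 ≤ d) (hα : Intercritical d α) {g : Space d → ℂ}
    (hg : g ∈ sobolevGroundStates d α) :
    hdotNorm (critSobolevExp d α) g = sobolevCritNorm d α := by
  have hα0 := (hα.mul_lt hd).1
  refine le_antisymm (le_iInf₂ fun g' hg' => le_of_eq ?_) (iInf₂_le g hg)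
  have h : functionalH α g = functionalH α g' := le_antisymm (hg'.2.1 hg.1) (hg.2.1 hg'.1)
  rw [functionalH_sobolevGroundState hd hα hg, functionalH_sobolevGroundState hd hα hg'] at h
  obtain ⟨-, hB, -⟩ := functionalH_pos_of_isMaxOn hd hα hg.2.1
  obtain ⟨-, hB', -⟩ := functionalH_pos_of_isMaxOn hd hα hg'.2.1
  exact (ENNReal.toReal_eq_toReal_iff' hg.1.2.1.ne hg'.1.2.1.ne).1
    (eq_of_div_rpow_eq hB hB' hα0 (by positivity) h)

/-! ### Lebesgue ground states -/

/-- Here it is `Δ²h` that is eliminated, leaving a pointwise relation between two different powers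
of `|h|`. -/
theorem coeff_eq_of_lebesgueGroundState (hd : 1 ≤ d) (hα : Intercritical d α) {h : Space d → ℂ}
    (hh : h ∈ lebesgueGroundStates d α) :
    (α + 2) / (lebNorm (α + 2) h).toReal ^ (α + 2) = 2 / (hdotNorm 2 h).toReal ^ 2 := by
  obtain ⟨hmem, hmax, heq⟩ := hh
  obtain ⟨f, hf⟩ := exists_isFourierModPoly hmem.2
  obtain ⟨hA, hB, hC⟩ := functionalK_pos_of_isMaxOn hd hα hmax
  have hEL := eulerLagrange_functionalK hd hα hmem hf hmax
  have hα0 := (hα.mul_lt hd).1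
  have hq := hα.two_lt_critLebesgueExp hd
  have hq2 := hα.critLebesgueExp_lt hd
  have hLq := hmem.1
  have hLp : MemLp h (ENNReal.ofReal (α + 2)) volume := memLp_of_toReal_lebNorm_pos hf.1 hA
  have hF := memLp_of_hdotNorm_lt_top hd hf hmem.2
  have hbil := hf.integral_mul_bilaplacian hd (by linarith) hLq hF
  set a := (α + 2) / (lebNorm (α + 2) h).toReal ^ (α + 2)
  set b := α / (lebNorm (critLebesgueExp d α) h).toReal ^ (critLebesgueExp d α)
  set c := 2 / (hdotNorm 2 h).toReal ^ 2
  set q := critLebesgueExp d α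
  have heq' : ∀ φ, pairSob 2 f φ + pairLeb (q - 2) h φ - pairLeb α h φ = 0 := fun φ => by
    rw [← hbil φ]; exact heq φ
  have hint1 : ∀ φ : 𝓢(Space d, ℂ), Integrable (fun x => ((‖h x‖ ^ α : ℝ) : ℂ) * h x * φ x) :=
    integrable_norm_rpow_mul (by linarith) hLp
  have hint2 : ∀ φ : 𝓢(Space d, ℂ),
      Integrable (fun x => ((‖h x‖ ^ (q - 2) : ℝ) : ℂ) * h x * φ x) :=
    integrable_norm_rpow_mul (by linarith) (by simpa using hLq)
  have hae := ae_eq_zero_of_integral_schwartz_eq_zero hd (F := fun x =>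
      ((a - c : ℝ) : ℂ) * (((‖h x‖ ^ α : ℝ) : ℂ) * h x) +
        ((c - b : ℝ) : ℂ) * (((‖h x‖ ^ (q - 2) : ℝ) : ℂ) * h x)) (by
    intro φ _
    have i1 := (hint1 φ).const_mul ((a - c : ℝ) : ℂ)
    have i2 := (hint2 φ).const_mul ((c - b : ℝ) : ℂ)
    have hlin : ((a - c : ℝ) : ℂ) * pairLeb α h φ + ((c - b : ℝ) : ℂ) * pairLeb (q - 2) h φ
        = 0 := by
      have h1 := heq' φ
      have h2 := hEL φ
      push_cast
      linear_combination (c : ℂ) * h1 + h2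
    simp only [add_mul, mul_assoc] at i1 i2 ⊢
    refine ⟨i1.add i2, ?_⟩
    rw [integral_add i1 i2, integral_const_mul, integral_const_mul, ← hlin, pairLeb, pairLeb]
    simp only [mul_assoc])
  by_contra hne
  have hne' : a - c ≠ 0 := sub_ne_zero.2 hne
  -- Since `q - 2 < α`, the relation forces `|h| = m` wherever `h ≠ 0`, so the difference of the
  -- nonlinear terms is a multiple of `h`.
  obtain ⟨κ, hκ⟩ : ∃ κ : ℝ, ∀ᵐ x, ((‖h x‖ ^ α : ℝ) : ℂ) * h x
      - ((‖h x‖ ^ (q - 2) : ℝ) : ℂ) * h x = κ * h x := by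
    set m := (-(c - b) / (a - c)) ^ (α - (q - 2))⁻¹
    refine ⟨m ^ α - m ^ (q - 2), ?_⟩
    filter_upwards [hae] with x hx
    by_cases hx0 : h x = 0
    · simp [hx0]
    have hnx := norm_pos_iff.2 hx0
    have h4 : (((a - c) * ‖h x‖ ^ α + (c - b) * ‖h x‖ ^ (q - 2) : ℝ) : ℂ) * h x = 0 := by
      rw [← hx]; push_cast; ring
    have h5 : (a - c) * ‖h x‖ ^ α + (c - b) * ‖h x‖ ^ (q - 2) = 0 := by
      exact_mod_cast (mul_eq_zero.1 h4).resolve_right hx0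
    have h6 : ‖h x‖ ^ α = ‖h x‖ ^ (α - (q - 2)) * ‖h x‖ ^ (q - 2) := by
      rw [← Real.rpow_add hnx]; congr 1; ring
    rw [h6, ← mul_assoc, ← add_mul] at h5
    have h7 := (mul_eq_zero.1 h5).resolve_right (by positivity)
    have h8 : ‖h x‖ ^ (α - (q - 2)) = -(c - b) / (a - c) := by
      rw [eq_div_iff hne']; linarith
    have h9 : ‖h x‖ = m := by
      rw [← Real.rpow_rpow_inv hnx.le (by linarith : α - (q - 2) ≠ 0), h8]
    rw [h9]
    push_cast
    ring
  -- The equation has become `Δ²h = κh`, so `f` lives where `(2π|ξ|)⁴ = κ`. Test functions vanishing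
  -- near the origin suffice, as `f` is only known against flat ones.
  have hf0 := ae_eq_zero_of_integral_schwartz_eq_zero hd (F := fun ξ =>
      (wt (2 * 2) ξ : ℂ) * f ξ - κ * f ξ) (by
    intro ψ hψ
    obtain ⟨-, j2, j3⟩ := hf.2.2 ψ (.of_eventually_eq_zero hψ)
    have i1 := integrable_wt_mul zero_le_two hF ψ
    have i2 := j2.const_mul (κ : ℂ)
    simp only [sub_mul, mul_assoc] at i1 i2 ⊢
    refine ⟨i1.sub i2, ?_⟩
    have h1 : pairLeb α h (𝓕 ψ) - pairLeb (q - 2) h (𝓕 ψ) = κ * ∫ x, h x * 𝓕 ψ x := by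
      rw [pairLeb, pairLeb, ← integral_sub (hint1 _) (hint2 _), ← integral_const_mul]
      refine integral_congr_ae ?_
      filter_upwards [hκ] with x hx
      rw [← sub_mul, hx, mul_assoc]
    have h2 := heq' (𝓕 ψ)
    rw [pairSob_fourier] at h2
    simp only [mul_assoc] at h2
    rw [integral_sub i1 i2, integral_const_mul, ← j3, ← h1]
    linear_combination h2)
  have hf0' : ∀ᵐ ξ, f ξ = 0 := by
    filter_upwards [hf0, ae_wt_ne hd (s := 2 * 2) (by norm_num) κ] with ξ h1 h2
    rw [← sub_mul, ← Complex.ofReal_sub] at h1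
    exact (mul_eq_zero.1 h1).resolve_left (by exact_mod_cast sub_ne_zero.2 h2)
  rw [(hdotNorm_eq_zero_iff hd hf 2).2 hf0'] at hC
  simp at hC

theorem functionalK_lebesgueGroundState (hd : 1 ≤ d) (hα : Intercritical d α) {h : Space d → ℂ}
    (hh : h ∈ lebesgueGroundStates d α) :
    functionalK α h = (α + 2) / 2 / (lebNorm (critLebesgueExp d α) h).toReal ^ α := by
  obtain ⟨hA, -, hC⟩ := functionalK_pos_of_isMaxOn hd hα hh.2.1
  exact quotient_eq (by positivity) (by positivity) (coeff_eq_of_lebesgueGroundState hd hα hh)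

theorem lebNorm_lebesgueGroundState (hd : 1 ≤ d) (hα : Intercritical d α) {h : Space d → ℂ}
    (hh : h ∈ lebesgueGroundStates d α) :
    lebNorm (critLebesgueExp d α) h = lebesgueCritNorm d α := by
  have hα0 := (hα.mul_lt hd).1
  refine le_antisymm (le_iInf₂ fun h' hh' => le_of_eq ?_) (iInf₂_le h hh)
  have e : functionalK α h = functionalK α h' := le_antisymm (hh'.2.1 hh.1) (hh.2.1 hh'.1)
  rw [functionalK_lebesgueGroundState hd hα hh, functionalK_lebesgueGroundState hd hα hh'] at e
  obtain ⟨-, hB, -⟩ := functionalK_pos_of_isMaxOn hd hα hh.2.1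
  obtain ⟨-, hB', -⟩ := functionalK_pos_of_isMaxOn hd hα hh'.2.1
  exact (ENNReal.toReal_eq_toReal_iff' hh.1.1.2.ne hh'.1.1.2.ne).1
    (eq_of_div_rpow_eq hB hB' hα0 (by positivity) e)

/-! ### Functions of zero energy -/

/-- The rescaling `l^{4/α} u(l x)`, which preserves both critical norms. -/
def rescale (α l : ℝ) (u : Space d → ℂ) : Space d → ℂ :=
  fun x => ((l ^ (4 / α) : ℝ) : ℂ) * u (l • x)

theorem eq_rescale {l : ℝ} (hl : 0 < l) (u : Space d → ℂ) (x : Space d) :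
    u x = Complex.exp (Complex.I * (0 : ℝ)) * (((l⁻¹) ^ (4 / α) : ℝ) : ℂ) *
      rescale α l u (l⁻¹ • x + 0) := by
  have h : (l⁻¹) ^ (4 / α) * l ^ (4 / α) = 1 := by
    rw [← Real.mul_rpow (inv_pos.2 hl).le hl.le, inv_mul_cancel₀ hl.ne', Real.one_rpow]
  have h' : (((l⁻¹) ^ (4 / α) : ℝ) : ℂ) * ((l ^ (4 / α) : ℝ) : ℂ) = 1 := by exact_mod_cast h
  rw [rescale, add_zero, smul_smul, mul_inv_cancel₀ hl.ne', one_smul, Complex.ofReal_zero, mul_zero,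
    Complex.exp_zero, one_mul, ← mul_assoc, h', one_mul]

theorem hdotNorm_rescale_crit (hd : 1 ≤ d) {u f : Space d → ℂ} (hf : IsFourierModPoly u f)
    {l : ℝ} (hl : 0 < l) :
    hdotNorm (critSobolevExp d α) (rescale α l u) = hdotNorm (critSobolevExp d α) u := by
  have e : 4 / α + (critSobolevExp d α - d / 2) = 0 := by rw [critSobolevExp]; ring
  unfold rescale
  rw [hdotNorm_dilate hd hf _ hl (by positivity), ← Real.rpow_add hl, e]
  simp

theorem hdotNorm_rescale_two (hd : 1 ≤ d) {u f : Space d → ℂ} (hf : IsFourierModPoly u f)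
    {l : ℝ} (hl : 0 < l) : hdotNorm 2 (rescale α l u) =
      ENNReal.ofReal (l ^ (2 - critSobolevExp d α)) * hdotNorm 2 u := by
  unfold rescale
  rw [hdotNorm_dilate hd hf _ hl (by positivity), ← Real.rpow_add hl]
  congr 3
  rw [critSobolevExp]
  ring

theorem lebNorm_rescale_crit (hd : 1 ≤ d) (hα : 0 < α) (u : Space d → ℂ) {l : ℝ} (hl : 0 < l) :
    lebNorm (critLebesgueExp d α) (rescale α l u) = lebNorm (critLebesgueExp d α) u := by
  have hd' : (0 : ℝ) < d := by exact_mod_cast hd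
  have e : 4 / α + -(d : ℝ) / critLebesgueExp d α = 0 := by
    rw [critLebesgueExp]; field_simp; ring
  unfold rescale
  rw [lebNorm_dilate u (by unfold critLebesgueExp; positivity) hl (by positivity),
    ← Real.rpow_add hl, e]
  simp

theorem sq_toReal_hdotNorm_rescale_two (hd : 1 ≤ d) {u f : Space d → ℂ}
    (hf : IsFourierModPoly u f) {l : ℝ} (hl : 0 < l) : (hdotNorm 2 (rescale α l u)).toReal ^ 2 =
      l ^ (2 * (2 - critSobolevExp d α)) * (hdotNorm 2 u).toReal ^ 2 := by
  rw [hdotNorm_rescale_two hd hf hl, ENNReal.toReal_mul, ENNReal.toReal_ofReal (by positivity),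
    mul_pow, mul_comm 2 (2 - _), Real.rpow_mul hl.le]
  norm_num

/-- The factor is the one in `sq_toReal_hdotNorm_rescale_two`: both terms of the energy scale alike,
so zero energy is preserved. -/
theorem toReal_lebNorm_rescale_rpow (hα : 0 < α) (u : Space d → ℂ) {l : ℝ} (hl : 0 < l) :
    (lebNorm (α + 2) (rescale α l u)).toReal ^ (α + 2) =
      l ^ (2 * (2 - critSobolevExp d α)) * (lebNorm (α + 2) u).toReal ^ (α + 2) := by
  unfold rescale
  rw [lebNorm_dilate u (by linarith) hl (by positivity), ENNReal.toReal_mul,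
    ENNReal.toReal_ofReal (by positivity), ← Real.rpow_add hl,
    Real.mul_rpow (by positivity) ENNReal.toReal_nonneg, ← Real.rpow_mul hl.le]
  congr 2
  rw [critSobolevExp]
  field_simp
  ring

/-- The dilation that turns the middle coefficient of the Euler–Lagrange equation into the last
one. -/
theorem exists_rpow_mul_eq {s B C : ℝ} (hs : s ≠ 0) (hα : 0 < α) (hB : 0 < B) (hC : 0 < C) :
    ∃ l : ℝ, 0 < l ∧ α / B = 2 / (l ^ s * C) := by
  refine ⟨(2 * B / (α * C)) ^ s⁻¹, by positivity, ?_⟩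
  rw [Real.rpow_inv_rpow (by positivity) hs]
  field_simp

/-- A function of zero energy with nonzero `Ḣ²` norm is in `L^{α+2}`. -/
theorem toReal_lebNorm_rpow_of_energy_eq_zero (hα : 0 < α) {u : Space d → ℂ}
    (hu : AEStronglyMeasurable u volume) (hC : 0 < (hdotNorm 2 u).toReal)
    (hE : energy α u = 0) :
    (lebNorm (α + 2) u).toReal ^ (α + 2) = (α + 2) / 2 * (hdotNorm 2 u).toReal ^ 2 := by
  have hI : ∫ x, ‖u x‖ ^ (α + 2) = (α + 2) / 2 * (hdotNorm 2 u).toReal ^ 2 := by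
    rw [energy, sub_eq_zero] at hE
    field_simp at hE ⊢
    linarith
  have hI0 : ∫ x, ‖u x‖ ^ (α + 2) ≠ 0 := by rw [hI]; positivity
  -- A non-integrable function has integral `0`, so a nonzero integral forces integrability.
  have hint : Integrable (fun x => ‖u x‖ ^ (α + 2)) := not_imp_comm.1 integral_undef hI0
  have hLp : MemLp u (ENNReal.ofReal (α + 2)) volume := by
    rw [← integrable_norm_rpow_iff hu (by simpa using by linarith) ENNReal.ofReal_ne_top,
      ENNReal.toReal_ofReal (by linarith)]
    exact hint
  rw [toReal_lebNorm_rpow (by linarith) hLp, hI]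

theorem coeff_eq_of_energy {A C : ℝ} (hα : 0 < α) (hC : 0 < C) (h : A = (α + 2) / 2 * C) :
    (α + 2) / A = 2 / C := by
  rw [h]
  field_simp

theorem exists_sobolevGroundState (hd : 1 ≤ d) (hα : Intercritical d α) {u : Space d → ℂ}
    (hu : u ∈ sobolevSpace d α)
    (hnorm : hdotNorm (critSobolevExp d α) u = sobolevCritNorm d α) (hE : energy α u = 0) :
    ∃ l : ℝ, 0 < l ∧ rescale α l u ∈ sobolevGroundStates d α := by
  have hα0 := (hα.mul_lt hd).1
  obtain ⟨⟨f, hf⟩, hB, hC⟩ := id hu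
  -- Without ground states the infimum would be `∞`, but the norm of `u` is finite.
  obtain ⟨g, hg⟩ : (sobolevGroundStates d α).Nonempty := by
    by_contra hempty
    rw [Set.not_nonempty_iff_eq_empty] at hempty
    rw [hnorm, sobolevCritNorm, hempty] at hB
    simp at hB
  have hBg : hdotNorm (critSobolevExp d α) u = hdotNorm (critSobolevExp d α) g :=
    hnorm.trans (hdotNorm_sobolevGroundState hd hα hg).symm
  obtain ⟨-, hBpos, -⟩ := functionalH_pos_of_isMaxOn hd hα hg.2.1
  rw [← hBg] at hBpos
  have hCpos : 0 < (hdotNorm 2 u).toReal := by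
    refine ENNReal.toReal_pos (fun h0 => ?_) hC.ne
    rw [hdotNorm_eq_zero_iff hd hf.modPoly] at h0
    rw [(hdotNorm_eq_zero_iff hd hf.modPoly _).2 h0] at hBpos
    simp at hBpos
  have hA := toReal_lebNorm_rpow_of_energy_eq_zero hα0 hf.1 hCpos hE
  obtain ⟨l, hl, hl'⟩ := exists_rpow_mul_eq (s := 2 * (2 - critSobolevExp d α))
    (by linarith [hα.critSobolevExp_lt hd]) hα0 (pow_pos hBpos 2) (pow_pos hCpos 2)
  refine ⟨l, hl, ?_⟩
  have hfv := hf.dilate hl ((l ^ (4 / α) : ℝ) : ℂ)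
  have hBv := hdotNorm_rescale_crit (α := α) hd hf.modPoly hl
  have hCv := sq_toReal_hdotNorm_rescale_two (α := α) hd hf.modPoly hl
  have hAv := toReal_lebNorm_rescale_rpow hα0 u hl
  have hmem : rescale α l u ∈ sobolevSpace d α := ⟨⟨_, hfv⟩, hBv ▸ hB, by
    rw [hdotNorm_rescale_two hd hf.modPoly hl]
    exact ENNReal.mul_lt_top ENNReal.ofReal_lt_top hC⟩
  have hls : 0 < l ^ (2 * (2 - critSobolevExp d α)) := Real.rpow_pos_of_pos hl _
  have hcoef := coeff_eq_of_energy (A := (lebNorm (α + 2) (rescale α l u)).toReal ^ (α + 2))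
    (C := (hdotNorm 2 (rescale α l u)).toReal ^ 2) hα0 (by rw [hCv]; positivity)
    (by rw [hAv, hCv, hA]; ring)
  have hval : functionalH α (rescale α l u) = functionalH α g := by
    rw [functionalH_sobolevGroundState hd hα hg, ← hBg, ← hBv]
    exact quotient_eq (by rw [hAv, hA]; positivity) (by rw [hCv]; positivity) hcoef
  have hmax : IsMaxOn (functionalH α) (sobolevSpace d α) (rescale α l u) := fun w hw => by
    change functionalH α w ≤ functionalH α (rescale α l u)
    rw [hval]
    exact hg.2.1 hw
  refine ⟨hmem, hmax, _, hfv, fun φ => ?_⟩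
  have hEL := eulerLagrange_functionalH hd hα hmem hfv hmax φ
  have hbil := hfv.integral_mul_bilaplacian φ
  -- Zero energy matches the first coefficient with the last, and the choice of `l` matches the
  -- middle one; the common factor can then be divided out.
  rw [hcoef, hBv, hl', ← hCv] at hEL
  have h2 : ((2 / (hdotNorm 2 (rescale α l u)).toReal ^ 2 : ℝ) : ℂ) ≠ 0 := by
    rw [hCv]
    exact_mod_cast (by positivity)
  change (∫ x, rescale α l u x * (Δ (Δ φ)) x) + pairSob (critSobolevExp d α) _ φ
    - pairLeb α (rescale α l u) φ = 0
  change (∫ x, rescale α l u x * (Δ (Δ φ)) x) = _ at hbil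
  rw [hbil]
  refine (mul_eq_zero.1 (?_ : ((2 / (hdotNorm 2 (rescale α l u)).toReal ^ 2 : ℝ) : ℂ) * _ = 0)
    ).resolve_left h2
  linear_combination -hEL

theorem exists_lebesgueGroundState (hd : 1 ≤ d) (hα : Intercritical d α) {u : Space d → ℂ}
    (hu : u ∈ lebesgueSpace d α)
    (hnorm : lebNorm (critLebesgueExp d α) u = lebesgueCritNorm d α) (hE : energy α u = 0) :
    ∃ l : ℝ, 0 < l ∧ rescale α l u ∈ lebesgueGroundStates d α := by
  have hα0 := (hα.mul_lt hd).1
  have hq := hα.two_lt_critLebesgueExp hd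
  obtain ⟨hB, hC⟩ := id hu
  obtain ⟨f, hf⟩ := exists_isFourierModPoly hC
  have hB' : lebNorm (critLebesgueExp d α) u < ⊤ := hB.2
  obtain ⟨g, hg⟩ : (lebesgueGroundStates d α).Nonempty := by
    by_contra hempty
    rw [Set.not_nonempty_iff_eq_empty] at hempty
    rw [hnorm, lebesgueCritNorm, hempty] at hB'
    simp at hB'
  have hBg : lebNorm (critLebesgueExp d α) u = lebNorm (critLebesgueExp d α) g :=
    hnorm.trans (lebNorm_lebesgueGroundState hd hα hg).symm
  obtain ⟨-, hBpos, -⟩ := functionalK_pos_of_isMaxOn hd hα hg.2.1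
  rw [← hBg] at hBpos
  -- A vanishing `Ḣ²` norm only kills the Fourier transform away from the origin; membership in
  -- `L^{α_c}` is what then gives `u = 0`.
  have hCpos : 0 < (hdotNorm 2 u).toReal := by
    refine ENNReal.toReal_pos (fun h0 => ?_) hC.ne
    rw [hdotNorm_eq_zero_iff hd hf] at h0
    rw [(lebNorm_eq_zero_iff (by linarith) hB.1).2
      (hf.ae_eq_zero hd (by linarith) hB h0)] at hBpos
    simp at hBpos
  have hA := toReal_lebNorm_rpow_of_energy_eq_zero hα0 hf.1 hCpos hE
  obtain ⟨l, hl, hl'⟩ := exists_rpow_mul_eq (s := 2 * (2 - critSobolevExp d α))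
    (by linarith [hα.critSobolevExp_lt hd]) hα0
    (Real.rpow_pos_of_pos hBpos (critLebesgueExp d α)) (pow_pos hCpos 2)
  refine ⟨l, hl, ?_⟩
  have hfv := hf.dilate hl ((l ^ (4 / α) : ℝ) : ℂ)
  have hBv := lebNorm_rescale_crit hd hα0 u hl
  have hCv := sq_toReal_hdotNorm_rescale_two (α := α) hd hf hl
  have hAv := toReal_lebNorm_rescale_rpow hα0 u hl
  have hmem : rescale α l u ∈ lebesgueSpace d α := ⟨⟨hfv.1, lt_of_eq_of_lt hBv hB'⟩, by
    rw [hdotNorm_rescale_two hd hf hl]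
    exact ENNReal.mul_lt_top ENNReal.ofReal_lt_top hC⟩
  have hls : 0 < l ^ (2 * (2 - critSobolevExp d α)) := Real.rpow_pos_of_pos hl _
  have hcoef := coeff_eq_of_energy (A := (lebNorm (α + 2) (rescale α l u)).toReal ^ (α + 2))
    (C := (hdotNorm 2 (rescale α l u)).toReal ^ 2) hα0 (by rw [hCv]; positivity)
    (by rw [hAv, hCv, hA]; ring)
  have hval : functionalK α (rescale α l u) = functionalK α g := by
    rw [functionalK_lebesgueGroundState hd hα hg, ← hBg, ← hBv]
    exact quotient_eq (by rw [hAv, hA]; positivity) (by rw [hCv]; positivity) hcoef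
  have hmax : IsMaxOn (functionalK α) (lebesgueSpace d α) (rescale α l u) := fun w hw => by
    change functionalK α w ≤ functionalK α (rescale α l u)
    rw [hval]
    exact hg.2.1 hw
  refine ⟨hmem, hmax, fun φ => ?_⟩
  have hEL := eulerLagrange_functionalK hd hα hmem hfv hmax φ
  have hbil := IsFourierModPoly.integral_mul_bilaplacian hd hfv (by linarith) hmem.1
    (memLp_of_hdotNorm_lt_top hd hfv hmem.2) φ
  rw [hcoef, hBv, hl', ← hCv] at hEL
  have h2 : ((2 / (hdotNorm 2 (rescale α l u)).toReal ^ 2 : ℝ) : ℂ) ≠ 0 := by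
    rw [hCv]
    exact_mod_cast (by positivity)
  change (∫ x, rescale α l u x * (Δ (Δ φ)) x)
    + pairLeb (critLebesgueExp d α - 2) (rescale α l u) φ - pairLeb α (rescale α l u) φ = 0
  change (∫ x, rescale α l u x * (Δ (Δ φ)) x) = _ at hbil
  rw [hbil]
  refine (mul_eq_zero.1 (?_ : ((2 / (hdotNorm 2 (rescale α l u)).toReal ^ 2 : ℝ) : ℂ) * _ = 0)
    ).resolve_left h2
  linear_combination -hEL

end FourthOrderNLS
end

/-! ### The main theorem -/

open FourthOrderNLS in
theorem mainTheorem10 (d : ℕ) (hd : 1 ≤ d) (α : ℝ) (hα : Intercritical d α) :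
    ((∀ g ∈ sobolevGroundStates d α,
        hdotNorm (critSobolevExp d α) g = sobolevCritNorm d α) ∧
      ∀ u ∈ sobolevSpace d α,
        hdotNorm (critSobolevExp d α) u = sobolevCritNorm d α → energy α u = 0 →
        ∃ g ∈ sobolevGroundStates d α, ∃ (θ lam : ℝ) (x₀ : Space d), 0 < lam ∧
          ∀ x, u x = Complex.exp (Complex.I * θ) * ((lam ^ (4 / α) : ℝ) : ℂ) * g (lam • x + x₀)) ∧
    ((∀ h ∈ lebesgueGroundStates d α,
        lebNorm (critLebesgueExp d α) h = lebesgueCritNorm d α) ∧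
      ∀ u ∈ lebesgueSpace d α,
        lebNorm (critLebesgueExp d α) u = lebesgueCritNorm d α → energy α u = 0 →
        ∃ h ∈ lebesgueGroundStates d α, ∃ (ϑ μ : ℝ) (y₀ : Space d), 0 < μ ∧
          ∀ x, u x = Complex.exp (Complex.I * ϑ) * ((μ ^ (4 / α) : ℝ) : ℂ) * h (μ • x + y₀)) := by
  refine ⟨⟨fun g hg => hdotNorm_sobolevGroundState hd hα hg, fun u hu hnorm hE => ?_⟩,
    ⟨fun h hh => lebNorm_lebesgueGroundState hd hα hh, fun u hu hnorm hE => ?_⟩⟩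
  · obtain ⟨l, hl, hg⟩ := exists_sobolevGroundState hd hα hu hnorm hE
    exact ⟨_, hg, 0, l⁻¹, 0, inv_pos.2 hl, eq_rescale hl u⟩
  · obtain ⟨l, hl, hg⟩ := exists_lebesgueGroundState hd hα hu hnorm hE
    exact ⟨_, hg, 0, l⁻¹, 0, inv_pos.2 hl, eq_rescale hl u⟩
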